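/- All vector spaces are over $\mathbb{Q}$. For a finite-dimensional graded vector space $V$, let $\mathbb{L}(V)$ be the free graded Lie algebra on $V$ and $\widehat{\mathbb L}(V)=\varprojlim_n \mathbb{L}(V)/\mathbb{L}^{>n}(V)$ its completion with respect to bracket length. A free cDGL is a pair $(\widehat{\mathbb L}(V),\partial)$ where $\partial$ is a filtration-preserving derivation of degree $-1$ with $\partial^2=0$. For each $n\ge 0$ let $\mathcal L_{\Delta^n}=(\widehat{\mathbb L}(s^{-1}C_*(\Delta^n)),\partial)$ be the cDGL model of the standard simplex: it is free on generators $a_{i_0\ldots i_p}$ of degree $p-1$, one for each simplex $0\le i_0<\dots<i_p\le n$ of $\Delta^n$, and the family $(\mathcal L_{\Delta^n})_{n\ge0}$ is characterized, up to isomorphism, by the following properties: (i) for every strictly increasing map $\{0,\dots,p\}\to\{0,\dots,n\}$, the induced morphism $\widehat{\mathbb L}(s^{-1}C_*(\Delta^p))\to\widehat{\mathbb L}(s^{-1}C_*(\Delta^n))$ commutes with the differentials; (ii) in $\mathcal L_{\Delta^0}=(\widehat{\mathbb L}(a),\partial)$ the generator $a$ is a Maurer–Cartan element, $\partial a=-\tfrac12[a,a]$;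 (iii) the linear part of $\partial$ is the desuspended simplicial boundary, $\partial_1 a_{i_0\ldots i_p}=\sum_{j=0}^p(-1)^j a_{i_0\ldots\widehat{i_j}\ldots i_p}$ for $p\ge1$ and $\partial_1 a_i=0$. For a finite simplicial complex $X$, regarded as a subcomplex of some $\Delta^n$, the completed Lie subalgebra $\widehat{\mathbb L}(s^{-1}C_*(X))$ of $\mathcal L_{\Delta^n}$ is preserved by $\partial$; the model of $X$ is $\mathcal L_X=(\widehat{\mathbb L}(s^{-1}C_*(X)),\partial)$. **Theorem.** If $X$ is a connected finite simplicial complex, then the homology of $\mathcal L_X$ with respect to the unperturbed differential $\partial$ vanishes in every degree: $H_k(\mathcal L_X,\partial)=0$ for all $k\in\mathbb{Z}$. -/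

import Mathlib

open CategoryTheory

noncomputable section

namespace LieModel

/-! ### Completed free graded Lie algebras

For a set `S` of homogeneous generators with degrees `deg : S → ℤ`, the completed tensor algebra on
the rational graded vector space with basis `S` is realised as the space of noncommutative formal
power series over `ℚ` in the variables `S` (for finite `S`). The free graded Lie algebra is the
sub Lie algebra generated by `S` for the graded commutator bracket, and its completion
`lim L(V) / L^{>n}(V)` is the space of all series whose components of each word length lie in it. -/

/-- Noncommutative formal power series: functions giving the coefficient of every word. -/
abbrev Series (S : Type*) : Type _ := List S → ℚ

/-- The degree of a word: the sum of the degrees of its letters. -/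
def wordDeg {S : Type*} (deg : S → ℤ) (w : List S) : ℤ := (w.map deg).sum

open Classical in
/-- The series consisting of the single one-letter word `s`. -/
def gen {S : Type*} (s : S) : Series S := Pi.single [s] 1

/-- The graded commutator `[f, g] = f g - (-1) ^ (|f| |g|) g f`, extended bilinearly to all series.
The product of two series has at the word `w` the sum over all ways to cut `w` in two. -/
def bracket {S : Type*} (deg : S → ℤ) (f g : Series S) : Series S := fun w =>
  ∑ i ∈ Finset.range (w.length + 1),
    (f (w.take i) * g (w.drop i)
      - (-1 : ℚ) ^ (wordDeg deg (w.take i) * wordDeg deg (w.drop i))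
          * (g (w.take i) * f (w.drop i)))

/-- Iterated brackets of generators from `A`. -/
inductive IsLieMonomial {S : Type*} (deg : S → ℤ) (A : Set S) : Series S → Prop
  | gen (s : S) (hs : s ∈ A) : IsLieMonomial deg A (gen s)
  | bracket (f g : Series S) (hf : IsLieMonomial deg A f) (hg : IsLieMonomial deg A g) :
      IsLieMonomial deg A (bracket deg f g)

/-- The free graded Lie algebra `L(A)` on the generators in `A`. -/
def freeLie {S : Type*} (deg : S → ℤ) (A : Set S) : Submodule ℚ (Series S) :=
  Submodule.span ℚ {f | IsLieMonomial deg A f}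

/-- The component of word length `k` of a series. -/
def lengthPart {S : Type*} (k : ℕ) : Series S →ₗ[ℚ] Series S where
  toFun f := fun w => if w.length = k then f w else 0
  map_add' f g := by
    funext w
    by_cases h : w.length = k <;> simp [h]
  map_smul' c f := by
    funext w
    by_cases h : w.length = k <;> simp [h]

/-- The completed free graded Lie algebra on the generators in `A`. -/
def completedFreeLie {S : Type*} (deg : S → ℤ) (A : Set S) : Submodule ℚ (Series S) where
  carrier := {f | ∀ k, lengthPart k f ∈ freeLie deg A}
  add_mem' hf hg k := by
    rw [map_add]
    exact add_mem (hf k) (hg k)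
  zero_mem' k := by
    rw [map_zero]
    exact zero_mem _
  smul_mem' c f hf k := by
    rw [map_smul]
    exact Submodule.smul_mem _ c (hf k)

/-- The series that are homogeneous of degree `n`. -/
def homogeneous {S : Type*} (deg : S → ℤ) (n : ℤ) : Submodule ℚ (Series S) where
  carrier := {f | ∀ w, wordDeg deg w ≠ n → f w = 0}
  add_mem' hf hg w hw := by simp [hf w hw, hg w hw]
  zero_mem' w _ := rfl
  smul_mem' c f hf w hw := by simp [hf w hw]

/-! Closure of the (completed) free Lie algebra under the bracket. -/

theorem wordDeg_append {S : Type*} (deg : S → ℤ) (u v : List S) :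
    wordDeg deg (u ++ v) = wordDeg deg u + wordDeg deg v := by
  simp [wordDeg]

/-- The bracket as a bilinear map. -/
def bracketBilin {S : Type*} (deg : S → ℤ) : Series S →ₗ[ℚ] Series S →ₗ[ℚ] Series S :=
  LinearMap.mk₂ ℚ (bracket deg)
    (fun f f' g => by
      funext w
      simp only [bracket, Pi.add_apply, ← Finset.sum_add_distrib]
      exact Finset.sum_congr rfl fun i _ => by ring)
    (fun c f g => by
      funext w
      simp only [bracket, Pi.smul_apply, smul_eq_mul, Finset.mul_sum]
      exact Finset.sum_congr rfl fun i _ => by ring)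
    (fun f g g' => by
      funext w
      simp only [bracket, Pi.add_apply, ← Finset.sum_add_distrib]
      exact Finset.sum_congr rfl fun i _ => by ring)
    (fun c f g => by
      funext w
      simp only [bracket, Pi.smul_apply, smul_eq_mul, Finset.mul_sum]
      exact Finset.sum_congr rfl fun i _ => by ring)

theorem bracketBilin_apply {S : Type*} (deg : S → ℤ) (f g : Series S) :
    bracketBilin deg f g = bracket deg f g := rfl

theorem bracket_mem_freeLie {S : Type*} {deg : S → ℤ} {A : Set S} {f g : Series S}
    (hf : f ∈ freeLie deg A) (hg : g ∈ freeLie deg A) : bracket deg f g ∈ freeLie deg A := by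
  rw [← bracketBilin_apply]
  have h := Submodule.apply_mem_map₂ (bracketBilin deg) hf hg
  rw [freeLie, Submodule.map₂_span_span] at h
  refine Submodule.span_mono ?_ h
  rintro _ ⟨a, ha, b, hb, rfl⟩
  exact IsLieMonomial.bracket a b ha hb

theorem lengthPart_bracket {S : Type*} (deg : S → ℤ) (k : ℕ) (f g : Series S) :
    lengthPart k (bracket deg f g)
      = ∑ p ∈ Finset.range (k + 1), bracket deg (lengthPart p f) (lengthPart (k - p) g) := by
  funext w
  simp only [lengthPart, bracket, LinearMap.coe_mk, AddHom.coe_mk, Finset.sum_apply]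
  rw [Finset.sum_comm]
  by_cases hw : w.length = k
  · rw [if_pos hw]
    refine Finset.sum_congr rfl fun i hi => ?_
    have hi' : i ≤ k := by rw [Finset.mem_range] at hi; omega
    rw [Finset.sum_sub_distrib]
    congr 1
    · rw [Finset.sum_eq_single i]
      · simp [hw, hi']
      · intro p _ hp
        rw [if_neg (by rw [List.length_take]; omega), zero_mul]
      · intro h
        exact absurd (Finset.mem_range.2 (by omega)) h
    · rw [Finset.sum_eq_single (k - i)]
      · rw [if_pos (by rw [List.length_take]; omega), if_pos (by rw [List.length_drop]; omega)]
      · intro p _ hp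
        rw [if_neg (c := (w.drop i).length = p) (by rw [List.length_drop]; omega), mul_zero,
          mul_zero]
      · intro h
        exact absurd (Finset.mem_range.2 (by omega)) h
  · rw [if_neg hw, eq_comm]
    refine Finset.sum_eq_zero fun i hi => Finset.sum_eq_zero fun p hp => ?_
    rw [Finset.mem_range] at hi hp
    have h1 : ¬ ((w.take i).length = p ∧ (w.drop i).length = k - p) := by
      rw [List.length_take, List.length_drop]; omega
    have h2 : ¬ ((w.take i).length = k - p ∧ (w.drop i).length = p) := by
      rw [List.length_take, List.length_drop]; omega
    rw [ite_zero_mul_ite_zero, ite_zero_mul_ite_zero, if_neg h1, if_neg h2, mul_zero, sub_zero]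

theorem bracket_mem_completedFreeLie {S : Type*} {deg : S → ℤ} {A : Set S} {f g : Series S}
    (hf : f ∈ completedFreeLie deg A) (hg : g ∈ completedFreeLie deg A) :
    bracket deg f g ∈ completedFreeLie deg A := by
  intro k
  rw [lengthPart_bracket]
  exact Submodule.sum_mem _ fun p _ => bracket_mem_freeLie (hf p) (hg (k - p))

theorem lengthPart_gen {S : Type*} (k : ℕ) (s : S) :
    lengthPart k (gen s) = if k = 1 then gen s else 0 := by
  funext w
  by_cases hw : w = [s]
  · subst hw
    by_cases hk : k = 1
    · simp [lengthPart, hk]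
    · simp [lengthPart, hk, Ne.symm hk]
  · by_cases hk : k = 1 <;> simp [lengthPart, gen, hw, hk]

theorem isLieMonomial_lengthPart {S : Type*} {deg : S → ℤ} {A : Set S} {f : Series S}
    (hf : IsLieMonomial deg A f) (k : ℕ) : lengthPart k f ∈ freeLie deg A := by
  induction hf generalizing k with
  | gen s hs =>
    rw [lengthPart_gen]
    split_ifs
    · exact Submodule.subset_span (IsLieMonomial.gen s hs)
    · exact zero_mem _
  | bracket f g _ _ ihf ihg =>
    rw [lengthPart_bracket]
    exact Submodule.sum_mem _ fun p _ => bracket_mem_freeLie (ihf p) (ihg (k - p))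

theorem freeLie_le_completedFreeLie {S : Type*} (deg : S → ℤ) (A : Set S) :
    freeLie deg A ≤ completedFreeLie deg A :=
  Submodule.span_le.2 fun _ hf k => isLieMonomial_lengthPart hf k

theorem isLieMonomial_mono {S : Type*} {deg : S → ℤ} {A B : Set S} (h : A ⊆ B) {f : Series S}
    (hf : IsLieMonomial deg A f) : IsLieMonomial deg B f := by
  induction hf with
  | gen s hs => exact IsLieMonomial.gen s (h hs)
  | bracket f g _ _ ihf ihg => exact IsLieMonomial.bracket f g ihf ihg

theorem completedFreeLie_mono {S : Type*} {deg : S → ℤ} {A B : Set S} (h : A ⊆ B) :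
    completedFreeLie deg A ≤ completedFreeLie deg B :=
  fun _ hf k => Submodule.span_mono (fun _ hg => isLieMonomial_mono h hg) (hf k)

theorem gen_mem {S : Type*} (deg : S → ℤ) {A : Set S} {s : S} (hs : s ∈ A) :
    gen s ∈ completedFreeLie deg A :=
  freeLie_le_completedFreeLie deg A (Submodule.subset_span (IsLieMonomial.gen s hs))

theorem bracket_mem_homogeneous {S : Type*} {deg : S → ℤ} {m n : ℤ} {f g : Series S}
    (hf : f ∈ homogeneous deg m) (hg : g ∈ homogeneous deg n) :
    bracket deg f g ∈ homogeneous deg (m + n) := by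
  intro w hw
  refine Finset.sum_eq_zero fun i _ => ?_
  have hsum : wordDeg deg (w.take i) + wordDeg deg (w.drop i) = wordDeg deg w := by
    rw [← wordDeg_append, List.take_append_drop]
  have h1 : f (w.take i) * g (w.drop i) = 0 := by
    by_cases h : wordDeg deg (w.take i) = m
    · rw [hg (w.drop i) (by omega), mul_zero]
    · rw [hf _ h, zero_mul]
  have h2 : g (w.take i) * f (w.drop i) = 0 := by
    by_cases h : wordDeg deg (w.take i) = n
    · rw [hf (w.drop i) (by omega), mul_zero]
    · rw [hg _ h, zero_mul]
  rw [h1, h2, mul_zero, sub_zero]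

theorem isLieMonomial_homogeneous {S : Type*} {deg : S → ℤ} {A : Set S} {f : Series S}
    (hf : IsLieMonomial deg A f) : ∃ n, f ∈ homogeneous deg n := by
  induction hf with
  | gen s _ =>
    refine ⟨deg s, fun w hw => ?_⟩
    have : w ≠ [s] := by
      rintro rfl
      exact hw (by simp [wordDeg])
    simp [gen, this]
  | bracket f g _ _ ihf ihg =>
    obtain ⟨m, hm⟩ := ihf
    obtain ⟨n, hn⟩ := ihg
    exact ⟨m + n, bracket_mem_homogeneous hm hn⟩

/-- The completed free graded Lie algebra on all generators. -/
abbrev CompletedFreeLie {S : Type*} (deg : S → ℤ) : Type _ :=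
  completedFreeLie deg (Set.univ : Set S)

/-- The Lie bracket of the completed free graded Lie algebra. -/
def lie {S : Type*} {deg : S → ℤ} (x y : CompletedFreeLie deg) : CompletedFreeLie deg :=
  ⟨bracket deg x y, bracket_mem_completedFreeLie x.2 y.2⟩

/-- A generator, as an element of the completed free graded Lie algebra. -/
def ofGen {S : Type*} (deg : S → ℤ) (s : S) : CompletedFreeLie deg :=
  ⟨gen s, gen_mem deg (Set.mem_univ s)⟩

/-! ### Free complete differential graded Lie algebras -/

/-- A free complete differential graded Lie algebra on the generators `S`: a differential of
degree `-1` on the completed free graded Lie algebra which is a graded derivation and respects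
the filtration by word length. -/
structure FreeCDGL {S : Type*} (deg : S → ℤ) where
  /-- the differential -/
  d : CompletedFreeLie deg →ₗ[ℚ] CompletedFreeLie deg
  d_degree : ∀ (n : ℤ) (x : CompletedFreeLie deg), (x : Series S) ∈ homogeneous deg n →
    (d x : Series S) ∈ homogeneous deg (n - 1)
  d_filtration : ∀ (k : ℕ) (x : CompletedFreeLie deg),
    (∀ w : List S, w.length ≤ k → (x : Series S) w = 0) →
      ∀ w : List S, w.length ≤ k → (d x : Series S) w = 0
  d_lie : ∀ (n : ℤ) (x y : CompletedFreeLie deg), (x : Series S) ∈ homogeneous deg n →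
    d (lie x y) = lie (d x) y + (-1 : ℚ) ^ n • lie x (d y)
  d_d : ∀ x : CompletedFreeLie deg, d (d x) = 0

/-- A free cDGL differential which sends the generators in `A` into the completed free Lie algebra
on `A` preserves this algebra. -/
theorem FreeCDGL.d_mem {S : Type*} {deg : S → ℤ} (L : FreeCDGL deg) {A : Set S}
    (hA : ∀ s ∈ A, (L.d (ofGen deg s) : Series S) ∈ completedFreeLie deg A)
    (x : CompletedFreeLie deg) (hx : (x : Series S) ∈ completedFreeLie deg A) :
    (L.d x : Series S) ∈ completedFreeLie deg A := by
  have hmono : ∀ (f : Series S) (_ : IsLieMonomial deg A f) (h : f ∈ completedFreeLie deg Set.univ),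
      (L.d ⟨f, h⟩ : Series S) ∈ completedFreeLie deg A := by
    intro f hf
    induction hf with
    | gen s hs => exact fun _ => hA s hs
    | bracket f g hf hg ihf ihg =>
      intro h
      have hfA := freeLie_le_completedFreeLie deg A (Submodule.subset_span hf)
      have hgA := freeLie_le_completedFreeLie deg A (Submodule.subset_span hg)
      have hfu := completedFreeLie_mono (Set.subset_univ A) hfA
      have hgu := completedFreeLie_mono (Set.subset_univ A) hgA
      obtain ⟨n, hn⟩ := isLieMonomial_homogeneous hf
      have key := L.d_lie n ⟨f, hfu⟩ ⟨g, hgu⟩ hn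
      have e : (⟨bracket deg f g, h⟩ : CompletedFreeLie deg) = lie ⟨f, hfu⟩ ⟨g, hgu⟩ := rfl
      rw [e, key]
      exact add_mem (bracket_mem_completedFreeLie (ihf hfu) hgA)
        (Submodule.smul_mem _ _ (bracket_mem_completedFreeLie hfA (ihg hgu)))
  have hfree : ∀ (f : Series S) (_ : f ∈ freeLie deg A) (h : f ∈ completedFreeLie deg Set.univ),
      (L.d ⟨f, h⟩ : Series S) ∈ completedFreeLie deg A := by
    intro f hf
    induction hf using Submodule.span_induction with
    | mem f hf => exact hmono f hf
    | zero =>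
      intro h
      have e : (⟨0, h⟩ : CompletedFreeLie deg) = 0 := rfl
      rw [e, map_zero]
      exact zero_mem _
    | add f g hf hg ihf ihg =>
      intro h
      have hfu := completedFreeLie_mono (Set.subset_univ A) (freeLie_le_completedFreeLie deg A hf)
      have hgu := completedFreeLie_mono (Set.subset_univ A) (freeLie_le_completedFreeLie deg A hg)
      have e : (⟨f + g, h⟩ : CompletedFreeLie deg) = ⟨f, hfu⟩ + ⟨g, hgu⟩ := rfl
      rw [e, map_add]
      exact add_mem (ihf hfu) (ihg hgu)
    | smul c f hf ihf =>
      intro h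
      have hfu := completedFreeLie_mono (Set.subset_univ A) (freeLie_le_completedFreeLie deg A hf)
      have e : (⟨c • f, h⟩ : CompletedFreeLie deg) = c • ⟨f, hfu⟩ := rfl
      rw [e, map_smul]
      exact Submodule.smul_mem _ c (ihf hfu)
  intro k
  have hT : (∑ i ∈ Finset.range (k + 1), lengthPart i (x : Series S)) ∈ freeLie deg A :=
    Submodule.sum_mem _ fun i _ => hx i
  have hTu := completedFreeLie_mono (Set.subset_univ A) (freeLie_le_completedFreeLie deg A hT)
  have hz := L.d_filtration k (x - ⟨_, hTu⟩) (by
    intro w hw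
    simp only [AddSubgroupClass.coe_sub, Pi.sub_apply, Finset.sum_apply, lengthPart,
      LinearMap.coe_mk, AddHom.coe_mk]
    rw [Finset.sum_ite_eq, if_pos (Finset.mem_range.2 (by omega)), sub_self])
  have heq : lengthPart k (L.d x : Series S) = lengthPart k (L.d ⟨_, hTu⟩ : Series S) := by
    funext w
    by_cases hw : w.length = k
    · have := hz w hw.le
      rw [map_sub] at this
      simp only [AddSubgroupClass.coe_sub, Pi.sub_apply] at this
      simp only [lengthPart, LinearMap.coe_mk, AddHom.coe_mk, if_pos hw]
      exact sub_eq_zero.1 this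
    · simp [lengthPart, hw]
  rw [heq]
  exact hfree _ hT hTu k

/-- The homogeneous elements of degree `n` of the completed free Lie algebra on `A`. -/
def degreePart {S : Type*} (deg : S → ℤ) (A : Set S) (n : ℤ) : Submodule ℚ (Series S) :=
  completedFreeLie deg A ⊓ homogeneous deg n

theorem degreePart_le {S : Type*} (deg : S → ℤ) (A : Set S) (n : ℤ) :
    degreePart deg A n ≤ completedFreeLie deg Set.univ :=
  inf_le_left.trans (completedFreeLie_mono (Set.subset_univ A))

/-- The differential from degree `n + 1` to degree `n` on the completed free Lie algebra on `A`, when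
`A` is a set of generators whose algebra is preserved by the differential. -/
def FreeCDGL.dPart {S : Type*} {deg : S → ℤ} (L : FreeCDGL deg) (A : Set S)
    (hA : ∀ s ∈ A, (L.d (ofGen deg s) : Series S) ∈ completedFreeLie deg A) (n : ℤ) :
    degreePart deg A (n + 1) →ₗ[ℚ] degreePart deg A n :=
  LinearMap.codRestrict (degreePart deg A n)
    ((completedFreeLie deg (Set.univ : Set S)).subtype ∘ₗ L.d ∘ₗ
      Submodule.inclusion (degreePart_le deg A (n + 1)))
    (fun x => ⟨L.d_mem hA _ x.2.1, by
      have h := L.d_degree (n + 1) (Submodule.inclusion (degreePart_le deg A (n + 1)) x) x.2.2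
      rwa [add_sub_cancel_right] at h⟩)

/-- The chain complex of rational vector spaces underlying the sub cDGL on a set `A` of generators
whose algebra is preserved by the differential. -/
def FreeCDGL.subComplex {S : Type*} {deg : S → ℤ} (L : FreeCDGL deg) (A : Set S)
    (hA : ∀ s ∈ A, (L.d (ofGen deg s) : Series S) ∈ completedFreeLie deg A) :
    ChainComplex (ModuleCat ℚ) ℤ :=
  ChainComplex.of (fun n => ModuleCat.of ℚ (degreePart deg A n))
    (fun n => ModuleCat.ofHom (L.dPart A hA n))
    (fun n => by
      ext x w
      exact congrFun (congrArg Subtype.val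
        (L.d_d (Submodule.inclusion (degreePart_le deg A (n + 1 + 1)) x))) w)

/-! ### Functoriality for injections of generators -/

/-- Renaming the letters along an injective map, as a map on series: the word `w` is sent to
`w.map φ`. -/
def pushforward {S T : Type*} (φ : S → T) : Series S →ₗ[ℚ] Series T :=
  Function.ExtendByZero.linearMap ℚ (List.map φ)

theorem pushforward_map {S T : Type*} {φ : S → T} (hφ : Function.Injective φ) (f : Series S)
    (w : List S) : pushforward φ f (w.map φ) = f w :=
  (List.map_injective_iff.2 hφ).extend_apply f (0 : Series T) w

theorem pushforward_of_notMem {S T : Type*} {φ : S → T} (f : Series S) {w : List T}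
    (hw : ¬ ∃ u : List S, u.map φ = w) : pushforward φ f w = 0 :=
  Function.extend_apply' f (0 : Series T) w hw

theorem pushforward_gen {S T : Type*} {φ : S → T} (hφ : Function.Injective φ) (s : S) :
    pushforward φ (gen s) = gen (φ s) := by
  funext w
  by_cases hw : ∃ u : List S, u.map φ = w
  · obtain ⟨u, rfl⟩ := hw
    rw [pushforward_map hφ]
    by_cases hu : u = [s]
    · subst hu
      simp [gen]
    · have : u.map φ ≠ [φ s] := fun h => hu ((List.map_injective_iff.2 hφ) (by simpa using h))
      simp [gen, hu, this]
  · have : w ≠ [φ s] := fun h => hw ⟨[s], by simp [h]⟩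
    rw [pushforward_of_notMem _ hw]
    simp [gen, this]

theorem lengthPart_pushforward {S T : Type*} {φ : S → T} (hφ : Function.Injective φ) (k : ℕ)
    (f : Series S) : lengthPart k (pushforward φ f) = pushforward φ (lengthPart k f) := by
  funext w
  by_cases hw : ∃ u : List S, u.map φ = w
  · obtain ⟨u, rfl⟩ := hw
    rw [pushforward_map hφ]
    simp [lengthPart, pushforward_map hφ]
  · rw [pushforward_of_notMem _ hw]
    simp [lengthPart, pushforward_of_notMem _ hw]

theorem pushforward_bracket {S T : Type*} {φ : S → T} (hφ : Function.Injective φ)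
    {deg : S → ℤ} {deg' : T → ℤ} (hdeg : ∀ s, deg' (φ s) = deg s) (f g : Series S) :
    pushforward φ (bracket deg f g) = bracket deg' (pushforward φ f) (pushforward φ g) := by
  have hword : ∀ u : List S, wordDeg deg' (u.map φ) = wordDeg deg u := by
    intro u
    simp [wordDeg, Function.comp_def, hdeg]
  funext w
  by_cases hw : ∃ u : List S, u.map φ = w
  · obtain ⟨u, rfl⟩ := hw
    rw [pushforward_map hφ]
    simp only [bracket, List.length_map, ← List.map_take, ← List.map_drop, pushforward_map hφ,
      hword]
  · rw [pushforward_of_notMem _ hw, eq_comm]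
    have key : ∀ (a b : Series S) (i : ℕ),
        pushforward φ a (w.take i) * pushforward φ b (w.drop i) = 0 := by
      intro a b i
      by_cases h1 : ∃ u : List S, u.map φ = w.take i
      · by_cases h2 : ∃ u : List S, u.map φ = w.drop i
        · obtain ⟨u, hu⟩ := h1
          obtain ⟨v, hv⟩ := h2
          exact absurd ⟨u ++ v, by rw [List.map_append, hu, hv, List.take_append_drop]⟩ hw
        · rw [pushforward_of_notMem b h2, mul_zero]
      · rw [pushforward_of_notMem a h1, zero_mul]
    refine Finset.sum_eq_zero fun i _ => ?_
    rw [key, key, mul_zero, sub_zero]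

theorem pushforward_mem {S T : Type*} {φ : S → T} (hφ : Function.Injective φ)
    {deg : S → ℤ} {deg' : T → ℤ} (hdeg : ∀ s, deg' (φ s) = deg s) {A : Set S} {f : Series S}
    (hf : f ∈ completedFreeLie deg A) : pushforward φ f ∈ completedFreeLie deg' (φ '' A) := by
  have hmono : ∀ g, IsLieMonomial deg A g → IsLieMonomial deg' (φ '' A) (pushforward φ g) := by
    intro g hg
    induction hg with
    | gen s hs =>
      rw [pushforward_gen hφ]
      exact IsLieMonomial.gen _ ⟨s, hs, rfl⟩
    | bracket f g _ _ ihf ihg =>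
      rw [pushforward_bracket hφ hdeg]
      exact IsLieMonomial.bracket _ _ ihf ihg
  intro k
  rw [lengthPart_pushforward hφ]
  have h := Submodule.mem_map_of_mem (f := pushforward φ) (hf k)
  rw [freeLie, Submodule.map_span] at h
  refine Submodule.span_mono ?_ h
  rintro _ ⟨g, hg, rfl⟩
  exact hmono g hg

/-- The morphism of completed free graded Lie algebras induced by a degree-preserving injection of
the generators. -/
def lieMap {S T : Type*} {deg : S → ℤ} {deg' : T → ℤ} (φ : S → T) (hφ : Function.Injective φ)
    (hdeg : ∀ s, deg' (φ s) = deg s) (x : CompletedFreeLie deg) : CompletedFreeLie deg' :=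
  ⟨pushforward φ x, completedFreeLie_mono (Set.subset_univ _) (pushforward_mem hφ hdeg x.2)⟩

/-! ### Models of the standard simplices -/

/-- The simplices of `Δⁿ`: nonempty sets of vertices, i.e. strictly increasing sequences. -/
abbrev Simplex (n : ℕ) : Type := {s : Finset (Fin (n + 1)) // s.Nonempty}

/-- The degree of the generator attached to a simplex: a `p`-simplex, which has `p + 1` vertices,
gives a generator of degree `p - 1`. -/
def simplexDeg (n : ℕ) (σ : Simplex n) : ℤ := (σ.1.card : ℤ) - 2

/-- The injection of simplices induced by an order embedding of the vertices. -/
def simplexMap {p n : ℕ} (φ : Fin (p + 1) ↪o Fin (n + 1)) (σ : Simplex p) : Simplex n :=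
  ⟨σ.1.map φ.toEmbedding, σ.2.map⟩

theorem simplexMap_injective {p n : ℕ} (φ : Fin (p + 1) ↪o Fin (n + 1)) :
    Function.Injective (simplexMap φ) := fun _ _ h =>
  Subtype.ext (Finset.map_injective _ (congrArg Subtype.val h))

theorem simplexDeg_simplexMap {p n : ℕ} (φ : Fin (p + 1) ↪o Fin (n + 1)) (σ : Simplex p) :
    simplexDeg n (simplexMap φ σ) = simplexDeg p σ := by
  simp [simplexDeg, simplexMap]

/-- The simplicial boundary `∑ⱼ (-1)ʲ (i₀, …, îⱼ, …, iₚ)` of a simplex, written in the generators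
attached to the simplices (the boundary of a vertex is zero). -/
def boundary (n : ℕ) (σ : Simplex n) : Series (Simplex n) :=
  ∑ v ∈ σ.1, if h : (σ.1.erase v).Nonempty then
    (-1 : ℚ) ^ (σ.1.filter (· < v)).card • gen (⟨σ.1.erase v, h⟩ : Simplex n) else 0

/-- The family of cDGL models of the standard simplices `Δⁿ`: free cDGLs on the desuspended
simplicial chains of `Δⁿ`, natural with respect to the injections `Δᵖ → Δⁿ`, with the generator of
the model of the point a Maurer-Cartan element, and with the linear part of the differential given
by the simplicial boundary. These properties determine the family up to isomorphism. -/
structure SimplexModels where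
  /-- the model of `Δⁿ` -/
  model : ∀ n : ℕ, FreeCDGL (simplexDeg n)
  natural : ∀ (p n : ℕ) (φ : Fin (p + 1) ↪o Fin (n + 1)) (x : CompletedFreeLie (simplexDeg p)),
    (model n).d (lieMap (simplexMap φ) (simplexMap_injective φ) (simplexDeg_simplexMap φ) x)
      = lieMap (simplexMap φ) (simplexMap_injective φ) (simplexDeg_simplexMap φ) ((model p).d x)
  maurerCartan : ∀ a : Simplex 0, (model 0).d (ofGen (simplexDeg 0) a)
    = -(1 / 2 : ℚ) • lie (ofGen (simplexDeg 0) a) (ofGen (simplexDeg 0) a)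
  linearPart : ∀ (n : ℕ) (σ : Simplex n),
    lengthPart 1 ((model n).d (ofGen (simplexDeg n) σ) : Series (Simplex n)) = boundary n σ

/-! ### Models of finite simplicial complexes -/

/-- The simplices of `Δⁿ` which belong to the complex `X` contained in `Δⁿ`. -/
def simplicesOf {n : ℕ} (X : PreAbstractSimplicialComplex (Fin (n + 1))) : Set (Simplex n) :=
  {σ | σ.1 ∈ X.faces}

/-- By naturality, the differential of the model of `Δⁿ` preserves the completed free Lie algebra on
the simplices of a complex contained in `Δⁿ`. -/
theorem SimplexModels.d_gen_mem (M : SimplexModels) {n : ℕ}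
    (X : PreAbstractSimplicialComplex (Fin (n + 1))) (σ : Simplex n) (hσ : σ ∈ simplicesOf X) :
    ((M.model n).d (ofGen (simplexDeg n) σ) : Series (Simplex n))
      ∈ completedFreeLie (simplexDeg n) (simplicesOf X) := by
  obtain ⟨p, hp⟩ : ∃ p, σ.1.card = p + 1 :=
    ⟨σ.1.card - 1, by have := σ.2.card_pos; omega⟩
  let φ : Fin (p + 1) ↪o Fin (n + 1) := σ.1.orderEmbOfFin hp
  let top : Simplex p := ⟨Finset.univ, Finset.univ_nonempty⟩
  have htop : simplexMap φ top = σ := by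
    apply Subtype.ext
    apply Finset.coe_injective
    simp [simplexMap, top, φ]
  have hgen : lieMap (simplexMap φ) (simplexMap_injective φ) (simplexDeg_simplexMap φ)
      (ofGen (simplexDeg p) top) = ofGen (simplexDeg n) σ := by
    apply Subtype.ext
    simp only [lieMap, ofGen]
    rw [pushforward_gen (simplexMap_injective φ), htop]
  rw [← hgen, M.natural]
  refine completedFreeLie_mono ?_ (pushforward_mem (simplexMap_injective φ)
    (simplexDeg_simplexMap φ) ((M.model p).d (ofGen (simplexDeg p) top)).2)
  rintro _ ⟨τ, -, rfl⟩
  refine (X.isRelLowerSet_faces hσ).2 ?_ (simplexMap φ τ).2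
  rw [← htop]
  exact Finset.map_subset_map.2 (Finset.subset_univ _)

/-- The chain complex underlying the cDGL model of a simplicial complex `X` contained in `Δⁿ`: the
completed free Lie algebra on the desuspended simplicial chains of `X`, with the (unperturbed)
differential of the model of `Δⁿ`. -/
def SimplexModels.complexModel (M : SimplexModels) {n : ℕ}
    (X : PreAbstractSimplicialComplex (Fin (n + 1))) : ChainComplex (ModuleCat ℚ) ℤ :=
  (M.model n).subComplex (simplicesOf X) (M.d_gen_mem X)

/-- The graph of vertices and edges of a simplicial complex. -/
def oneSkeleton {ι : Type*} [DecidableEq ι] (X : PreAbstractSimplicialComplex ι) :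
    SimpleGraph {v : ι // {v} ∈ X.faces} where
  Adj u v := u ≠ v ∧ {u.1, v.1} ∈ X.faces
  symm := ⟨fun u v h => ⟨h.1.symm, by rw [Finset.pair_comm]; exact h.2⟩⟩
  loopless := ⟨fun _ h => h.1 rfl⟩

/-- A simplicial complex is connected if it is nonempty and any two of its vertices are joined by
a path of edges. -/
def IsConnected {ι : Type*} [DecidableEq ι] (X : PreAbstractSimplicialComplex ι) : Prop :=
  (oneSkeleton X).Connected

end LieModel

end

open CategoryTheory

noncomputable section

namespace LieModel

open scoped TensorProduct

/-! ### Words in the free associative algebra -/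

/-! Let `ε` be the augmentation of the simplicial chains (1 on vertices, 0 on other simplices), and
let `h` be the map of degree 1 on the tensor algebra that deletes the first letter `s` of a word and
multiplies by `ε s`. For a superderivation `δ` of degree -1 whose values on generators have no
constant term, `δh + hδ` sends a word `s w` to `h(δ s) w`. For the differential of the model, the
linear part of `δ s` contributes the augmentation of a boundary, which is 0, and the quadratic part
contributes `-s`. Hence `δh + hδ = -id` up to longer words, so `-h` is a contracting homotopy on
nonempty words to leading order in length.

The quadratic part: degrees, and the fact that `dσ` only involves faces of `σ`, force the
contraction of the quadratic part of `dσ` to be a multiple `c(σ) σ`. The identity `d² = 0` in low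
length gives `c(σ) = c(τ)` whenever `τ` occurs in the linear part of `dσ`
(`quadratic_contraction_comm`). On a vertex the Maurer-Cartan equation reads `da = -a·a`, so `c =
-1` there, and descending along facets gives `c = -1` everywhere (`quadratic_contraction`).

Since `h` does not preserve Lie elements, its output is projected back by an operator commuting with
`δ`, built from the second Adams operation `ψ`: the coproduct with primitive generators, followed by
the product. The values of `δ` on generators are Lie, hence primitive, so `δ` is a coderivation and
commutes with `ψ` (`adams_superderivation`). On products of `k` Lie elements `ψ` is `2 ^ k` modulo
products of fewer factors, so a polynomial in `ψ` maps products of boundedly many Lie elements to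
Lie polynomials and fixes those that are already Lie (`lieProjection`). The graded tensor square
enters only as a module on which coproducts act by left multiplication, the Koszul signs being
carried by `twist`.

A cycle `x` starting in length `j + 1` is therefore, to leading order, the boundary of `-P(h x)`,
where `P` is this projection (`exists_approx_d_eq`). The corrections live in increasing length, so
they can be summed in the completed algebra (`exists_d_eq`). Neither `h` nor `P` introduces new
letters, so the argument applies to the generators of any subcomplex. -/

/-- The monomial of the free associative algebra attached to a word. -/
def word {S : Type*} (w : List S) : FreeAlgebra ℚ S := (w.map (FreeAlgebra.ι ℚ)).prod

@[simp]
theorem word_nil {S : Type*} : word ([] : List S) = 1 := rfl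

theorem word_cons {S : Type*} (s : S) (w : List S) :
    word (s :: w) = FreeAlgebra.ι ℚ s * word w := by
  simp [word]

theorem word_singleton {S : Type*} (s : S) : word [s] = FreeAlgebra.ι ℚ s := by
  simp [word]

theorem word_append {S : Type*} (u v : List S) : word (u ++ v) = word u * word v := by
  simp [word]

/-- The basis of the free associative algebra given by the words. -/
def wordBasis (S : Type*) : Module.Basis (List S) ℚ (FreeAlgebra ℚ S) :=
  (FreeAlgebra.basisFreeMonoid ℚ S).reindex FreeMonoid.toList

theorem wordBasis_apply {S : Type*} (w : List S) : wordBasis S w = word w := by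
  simp [wordBasis, FreeAlgebra.basisFreeMonoid, FreeAlgebra.equivMonoidAlgebraFreeMonoid, word]

theorem linearMap_ext_word {S M : Type*} [AddCommGroup M] [Module ℚ M]
    {f g : FreeAlgebra ℚ S →ₗ[ℚ] M} (h : ∀ w, f (word w) = g (word w)) : f = g :=
  (wordBasis S).ext fun w => by rw [wordBasis_apply, h]

/-- The linear map with prescribed values on the words. -/
def wordLift {S M : Type*} [AddCommGroup M] [Module ℚ M] (f : List S → M) :
    FreeAlgebra ℚ S →ₗ[ℚ] M :=
  (wordBasis S).constr ℚ f

@[simp]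
theorem wordLift_word {S M : Type*} [AddCommGroup M] [Module ℚ M] (f : List S → M) (w : List S) :
    wordLift f (word w) = f w := by
  rw [← wordBasis_apply, wordLift, Module.Basis.constr_basis]

/-- The elements of the free associative algebra supported on the words satisfying `p`. -/
def supported {S : Type*} (p : List S → Prop) : Submodule ℚ (FreeAlgebra ℚ S) :=
  Submodule.span ℚ (word '' {w | p w})

theorem word_mem_supported {S : Type*} {p : List S → Prop} {w : List S} (hw : p w) :
    word w ∈ supported p :=
  Submodule.subset_span ⟨w, hw, rfl⟩

theorem mem_supported_iff {S : Type*} {p : List S → Prop} {x : FreeAlgebra ℚ S} :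
    x ∈ supported p ↔ ∀ w, ¬ p w → (wordBasis S).repr x w = 0 := by
  have h : (word : List S → FreeAlgebra ℚ S) = wordBasis S :=
    funext fun w => (wordBasis_apply w).symm
  rw [supported, h, Module.Basis.mem_span_image]
  simp only [Set.subset_def, Finset.mem_coe, Finsupp.mem_support_iff, Set.mem_ofPred_eq]
  exact forall_congr' fun w => by tauto

theorem repr_word {S : Type*} (w : List S) :
    (wordBasis S).repr (word w) = Finsupp.single w 1 := by
  rw [← wordBasis_apply, Module.Basis.repr_self]

theorem supported_mono {S : Type*} {p q : List S → Prop} (h : ∀ w, p w → q w) :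
    supported p ≤ supported q :=
  Submodule.span_mono (Set.image_mono h)

theorem supported_le {S : Type*} {p : List S → Prop} {N : Submodule ℚ (FreeAlgebra ℚ S)}
    (h : ∀ w, p w → word w ∈ N) : supported p ≤ N := by
  refine Submodule.span_le.2 ?_
  rintro _ ⟨w, hw, rfl⟩
  exact h w hw

theorem mem_supported_true {S : Type*} (x : FreeAlgebra ℚ S) : x ∈ supported fun _ => True :=
  mem_supported_iff.2 fun _ h => absurd trivial h

theorem mul_mem_supported {S : Type*} {p q r : List S → Prop}
    (h : ∀ u v, p u → q v → r (u ++ v)) {x y : FreeAlgebra ℚ S} (hx : x ∈ supported p)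
    (hy : y ∈ supported q) : x * y ∈ supported r := by
  have := Submodule.mul_mem_mul hx hy
  rw [supported, supported, Submodule.span_mul_span] at this
  refine Submodule.span_le.2 ?_ this
  rintro _ ⟨_, ⟨u, hu, rfl⟩, _, ⟨v, hv, rfl⟩, rfl⟩
  change word u * word v ∈ _
  rw [← word_append]
  exact word_mem_supported (h u v hu hv)

/-! ### Parity twists and superderivations -/

/-- The algebra endomorphism multiplying a word of degree `m` by `(-1) ^ (e * m)`. -/
def twist {S : Type*} (deg : S → ℤ) (e : ℤ) : FreeAlgebra ℚ S →ₐ[ℚ] FreeAlgebra ℚ S :=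
  FreeAlgebra.lift ℚ fun s => (-1 : ℚ) ^ (e * deg s) • FreeAlgebra.ι ℚ s

@[simp]
theorem twist_ι {S : Type*} (deg : S → ℤ) (e : ℤ) (s : S) :
    twist deg e (FreeAlgebra.ι ℚ s) = (-1 : ℚ) ^ (e * deg s) • FreeAlgebra.ι ℚ s := by
  simp [twist]

theorem wordDeg_cons {S : Type*} (deg : S → ℤ) (s : S) (w : List S) :
    wordDeg deg (s :: w) = deg s + wordDeg deg w := by
  simp [wordDeg]

theorem neg_one_zpow_add (a b : ℤ) : (-1 : ℚ) ^ (a + b) = (-1) ^ a * (-1) ^ b :=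
  zpow_add₀ (by norm_num) a b

theorem neg_one_zpow_mul_self (a : ℤ) : (-1 : ℚ) ^ a * (-1) ^ a = 1 := by
  rw [← mul_zpow]; simp

theorem twist_word {S : Type*} (deg : S → ℤ) (e : ℤ) (w : List S) :
    twist deg e (word w) = (-1 : ℚ) ^ (e * wordDeg deg w) • word w := by
  induction w with
  | nil => simp [wordDeg]
  | cons s w ih =>
    rw [word_cons, map_mul, ih, twist_ι, wordDeg_cons, mul_add, neg_one_zpow_add,
      smul_mul_smul_comm]

theorem twist_of_mem_supported {S : Type*} {deg : S → ℤ} (e : ℤ) {m : ℤ} {x : FreeAlgebra ℚ S}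
    (hx : x ∈ supported fun w => wordDeg deg w = m) :
    twist deg e x = (-1 : ℚ) ^ (e * m) • x := by
  induction hx using Submodule.span_induction with
  | mem x hx =>
    obtain ⟨w, rfl, rfl⟩ := hx
    rw [twist_word]
  | zero => simp
  | add x y _ _ hx hy => rw [map_add, hx, hy, smul_add]
  | smul c x _ hx => rw [map_smul, hx, smul_comm]

theorem twist_twist {S : Type*} (deg : S → ℤ) (e m : ℤ) (x : FreeAlgebra ℚ S) :
    twist deg e (twist deg m x) = twist deg (m + e) x := by
  have : (twist deg e).toLinearMap ∘ₗ (twist deg m).toLinearMap = (twist deg (m + e)).toLinearMap :=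
    linearMap_ext_word fun w => by
      simp only [LinearMap.comp_apply, AlgHom.toLinearMap_apply, twist_word, map_smul, smul_smul]
      rw [add_mul, neg_one_zpow_add]
  exact LinearMap.congr_fun this x

/-- The value of a superderivation on a word. -/
def superderivationWord {S : Type*} (deg : S → ℤ) (e : ℤ) (g : S → FreeAlgebra ℚ S) :
    List S → FreeAlgebra ℚ S
  | [] => 0
  | s :: w => g s * word w
      + (-1 : ℚ) ^ (e * deg s) • (FreeAlgebra.ι ℚ s * superderivationWord deg e g w)

/-- The superderivation of degree `e` with prescribed values on the generators. -/
def superderivation {S : Type*} (deg : S → ℤ) (e : ℤ) (g : S → FreeAlgebra ℚ S) :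
    FreeAlgebra ℚ S →ₗ[ℚ] FreeAlgebra ℚ S :=
  wordLift (superderivationWord deg e g)

section Superderivation

variable {S : Type*} {deg : S → ℤ} {e : ℤ} {g : S → FreeAlgebra ℚ S}

@[simp]
theorem superderivation_one : superderivation deg e g 1 = 0 := by
  rw [← word_nil, superderivation, wordLift_word]; rfl

theorem superderivation_word_cons (s : S) (w : List S) :
    superderivation deg e g (word (s :: w)) = g s * word w
      + (-1 : ℚ) ^ (e * deg s) • (FreeAlgebra.ι ℚ s * superderivation deg e g (word w)) := by
  simp only [superderivation, wordLift_word]; rfl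

@[simp]
theorem superderivation_ι (s : S) : superderivation deg e g (FreeAlgebra.ι ℚ s) = g s := by
  rw [← word_singleton, superderivation_word_cons]; simp

theorem superderivation_word_mul (u : List S) (y : FreeAlgebra ℚ S) :
    superderivation deg e g (word u * y) = superderivation deg e g (word u) * y
      + twist deg e (word u) * superderivation deg e g y := by
  suffices h : ∀ v, superderivation deg e g (word u * word v)
      = superderivation deg e g (word u) * word v
        + twist deg e (word u) * superderivation deg e g (word v) by
    have := linearMap_ext_word (f := superderivation deg e g ∘ₗ LinearMap.mulLeft ℚ (word u))
      (g := LinearMap.mulLeft ℚ (superderivation deg e g (word u))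
        + LinearMap.mulLeft ℚ (twist deg e (word u)) ∘ₗ superderivation deg e g) (fun v => by
        simpa only [LinearMap.comp_apply, LinearMap.add_apply, LinearMap.mulLeft_apply] using h v)
    exact LinearMap.congr_fun this y
  intro v
  induction u with
  | nil => simp
  | cons s u ih =>
    rw [← word_append, List.cons_append, superderivation_word_cons, word_append, ih,
      superderivation_word_cons, twist_word, twist_word, wordDeg_cons, mul_add e, neg_one_zpow_add,
      word_cons]
    simp only [mul_add, add_mul, smul_add, smul_mul_assoc, mul_smul_comm, smul_smul, mul_assoc,
      add_assoc]

theorem superderivation_mul (x y : FreeAlgebra ℚ S) :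
    superderivation deg e g (x * y) = superderivation deg e g x * y
      + twist deg e x * superderivation deg e g y := by
  have := linearMap_ext_word (f := superderivation deg e g ∘ₗ LinearMap.mulRight ℚ y)
      (g := LinearMap.mulRight ℚ y ∘ₗ superderivation deg e g
        + LinearMap.mulRight ℚ (superderivation deg e g y) ∘ₗ (twist deg e).toLinearMap)
      (fun u => by
        simp only [LinearMap.comp_apply, LinearMap.add_apply, LinearMap.mulRight_apply,
          AlgHom.toLinearMap_apply]
        exact superderivation_word_mul u y)
  exact LinearMap.congr_fun this x

/-- The superderivation shifts degrees by `e`, so the sign applied after it exceeds the sign applied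
before it by `(-1) ^ (e * m)`. -/
theorem superderivation_twist (hg : ∀ s, g s ∈ supported fun w => wordDeg deg w = deg s + e)
    (m : ℤ) (x : FreeAlgebra ℚ S) :
    superderivation deg e g (twist deg m x)
      = (-1 : ℚ) ^ (e * m) • twist deg m (superderivation deg e g x) := by
  have := linearMap_ext_word (f := superderivation deg e g ∘ₗ (twist deg m).toLinearMap)
      (g := (-1 : ℚ) ^ (e * m) • (twist deg m).toLinearMap ∘ₗ superderivation deg e g) (by
    intro w
    simp only [LinearMap.comp_apply, AlgHom.toLinearMap_apply, LinearMap.smul_apply]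
    induction w with
    | nil => simp
    | cons s w ih =>
      rw [twist_word, map_smul] at ih
      rw [twist_word, map_smul, superderivation_word_cons, map_add, map_mul, map_smul, map_mul,
        twist_of_mem_supported m (hg s), twist_word, twist_ι]
      have ih' : twist deg m (superderivation deg e g (word w))
          = (-1 : ℚ) ^ (e * m) • (-1 : ℚ) ^ (m * wordDeg deg w) •
            superderivation deg e g (word w) := by
        rw [ih, smul_smul, neg_one_zpow_mul_self, one_smul]
      rw [ih', wordDeg_cons]
      simp only [smul_add, smul_mul_assoc, mul_smul_comm, smul_smul]
      have h := neg_one_zpow_mul_self (e * m)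
      congr 2
      · rw [mul_add, mul_add, neg_one_zpow_add, neg_one_zpow_add, mul_comm m e]
        linear_combination (-(-1 : ℚ) ^ (m * deg s) * (-1 : ℚ) ^ (m * wordDeg deg w)) * h
      · rw [mul_add, neg_one_zpow_add]
        linear_combination (-(-1 : ℚ) ^ (m * deg s) * (-1 : ℚ) ^ (m * wordDeg deg w)
          * (-1 : ℚ) ^ (e * deg s)) * h)
  exact LinearMap.congr_fun this x

end Superderivation

/-! ### Lie polynomials -/

/-- Iterated graded commutators of generators from `A` in the free associative algebra, together
with their degrees. -/
inductive IsLieWord {S : Type*} (deg : S → ℤ) (A : Set S) : ℤ → FreeAlgebra ℚ S → Prop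
  | gen (s : S) (hs : s ∈ A) : IsLieWord deg A (deg s) (FreeAlgebra.ι ℚ s)
  | bracket (m n : ℤ) (x y : FreeAlgebra ℚ S) (hx : IsLieWord deg A m x)
      (hy : IsLieWord deg A n y) :
      IsLieWord deg A (m + n) (x * y - (-1 : ℚ) ^ (m * n) • (y * x))

/-- The free graded Lie algebra on the generators in `A`, inside the free associative algebra. -/
def liePoly {S : Type*} (deg : S → ℤ) (A : Set S) : Submodule ℚ (FreeAlgebra ℚ S) :=
  Submodule.span ℚ {x | ∃ m, IsLieWord deg A m x}

section LiePoly

variable {S : Type*} {deg : S → ℤ} {A : Set S}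

theorem IsLieWord.mem_liePoly {m : ℤ} {x : FreeAlgebra ℚ S} (hx : IsLieWord deg A m x) :
    x ∈ liePoly deg A :=
  Submodule.subset_span ⟨m, hx⟩

theorem IsLieWord.mem_supported {m : ℤ} {x : FreeAlgebra ℚ S} (hx : IsLieWord deg A m x) :
    x ∈ supported fun w => wordDeg deg w = m := by
  induction hx with
  | gen s hs =>
    rw [← word_singleton]
    exact word_mem_supported (by simp [wordDeg])
  | bracket m n x y _ _ hx hy =>
    refine sub_mem (mul_mem_supported ?_ hx hy)
      (Submodule.smul_mem _ _ (mul_mem_supported ?_ hy hx))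
    · intro u v hu hv
      rw [wordDeg_append, hu, hv]
    · intro u v hu hv
      rw [wordDeg_append, hu, hv, add_comm]

/-! ### The shuffle coproduct -/

/-- The action of `1 ⊗ x` on the graded tensor square of the free associative algebra by left
multiplication. -/
def rightAction (deg : S → ℤ) :
    FreeAlgebra ℚ S →ₐ[ℚ] Module.End ℚ (FreeAlgebra ℚ S ⊗[ℚ] FreeAlgebra ℚ S) :=
  FreeAlgebra.lift ℚ fun s => TensorProduct.map (twist deg (deg s)).toLinearMap
    (LinearMap.mulLeft ℚ (FreeAlgebra.ι ℚ s))

/-- The action of the coproduct of `x` on the graded tensor square of the free associative algebra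
by left multiplication, for the coproduct in which the generators are primitive. -/
def coproductAction (deg : S → ℤ) :
    FreeAlgebra ℚ S →ₐ[ℚ] Module.End ℚ (FreeAlgebra ℚ S ⊗[ℚ] FreeAlgebra ℚ S) :=
  FreeAlgebra.lift ℚ fun s =>
    TensorProduct.map (LinearMap.mulLeft ℚ (FreeAlgebra.ι ℚ s)) LinearMap.id
    + rightAction deg (FreeAlgebra.ι ℚ s)

theorem rightAction_ι_tmul (s : S) (a b : FreeAlgebra ℚ S) :
    rightAction deg (FreeAlgebra.ι ℚ s) (a ⊗ₜ b)
      = twist deg (deg s) a ⊗ₜ (FreeAlgebra.ι ℚ s * b) := by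
  simp [rightAction]

theorem rightAction_word_tmul (w : List S) (a b : FreeAlgebra ℚ S) :
    rightAction deg (word w) (a ⊗ₜ b) = twist deg (wordDeg deg w) a ⊗ₜ (word w * b) := by
  induction w with
  | nil =>
    have : twist deg 0 a = a := by
      have := linearMap_ext_word (f := (twist deg 0).toLinearMap) (g := LinearMap.id)
        (fun w => by simp [twist_word])
      exact LinearMap.congr_fun this a
    simp [wordDeg, this]
  | cons s w ih =>
    rw [word_cons, map_mul, Module.End.mul_apply, ih, rightAction_ι_tmul, twist_twist,
      wordDeg_cons, add_comm, mul_assoc]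

/-- The twist of `a` is the Koszul sign for moving `x` past the left tensor factor. -/
theorem rightAction_tmul {m : ℤ} {x : FreeAlgebra ℚ S}
    (hx : x ∈ supported fun w => wordDeg deg w = m) (a b : FreeAlgebra ℚ S) :
    rightAction deg x (a ⊗ₜ b) = twist deg m a ⊗ₜ (x * b) := by
  induction hx using Submodule.span_induction with
  | mem x hx =>
    obtain ⟨w, rfl, rfl⟩ := hx
    rw [rightAction_word_tmul]
  | zero => simp
  | add x y _ _ hx hy => rw [map_add, LinearMap.add_apply, hx, hy, add_mul, TensorProduct.tmul_add]
  | smul c x _ hx =>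
    rw [map_smul, LinearMap.smul_apply, hx, smul_mul_assoc, TensorProduct.tmul_smul]

theorem coproductAction_ι (s : S) : coproductAction deg (FreeAlgebra.ι ℚ s)
    = TensorProduct.map (LinearMap.mulLeft ℚ (FreeAlgebra.ι ℚ s)) LinearMap.id
      + rightAction deg (FreeAlgebra.ι ℚ s) := by
  simp [coproductAction]

/-- Lie words are primitive: in the graded commutator of two primitive elements the mixed terms `x ⊗
y` and `y ⊗ x` cancel because of the Koszul signs. -/
theorem IsLieWord.coproductAction_tmul {m : ℤ} {x : FreeAlgebra ℚ S} (hx : IsLieWord deg A m x)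
    (a b : FreeAlgebra ℚ S) :
    coproductAction deg x (a ⊗ₜ b) = (x * a) ⊗ₜ b + twist deg m a ⊗ₜ (x * b) := by
  induction hx generalizing a b with
  | gen s hs =>
    rw [coproductAction_ι, LinearMap.add_apply, rightAction_ι_tmul]
    simp
  | bracket m n x y hx hy ihx ihy =>
    rw [map_sub, map_smul, map_mul, map_mul]
    simp only [LinearMap.sub_apply, LinearMap.smul_apply, Module.End.mul_apply, ihx, ihy, map_add,
      map_mul, twist_twist, twist_of_mem_supported _ hx.mem_supported,
      twist_of_mem_supported _ hy.mem_supported, smul_add, sub_mul, TensorProduct.sub_tmul,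
      TensorProduct.tmul_sub, smul_mul_assoc, TensorProduct.smul_tmul', TensorProduct.tmul_smul,
      smul_smul, ← mul_assoc, mul_comm n m, add_comm n m, neg_one_zpow_mul_self, one_smul]
    abel

theorem coproductAction_of_mem_liePoly {x : FreeAlgebra ℚ S} (hx : x ∈ liePoly deg A) :
    coproductAction deg x
      = TensorProduct.map (LinearMap.mulLeft ℚ x) LinearMap.id + rightAction deg x := by
  induction hx using Submodule.span_induction with
  | mem x hx =>
    obtain ⟨m, hx⟩ := hx
    refine TensorProduct.ext' fun a b => ?_
    rw [hx.coproductAction_tmul, LinearMap.add_apply, rightAction_tmul hx.mem_supported]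
    simp
  | zero => ext; simp
  | add x y _ _ hx hy =>
    refine TensorProduct.ext' fun a b => ?_
    rw [map_add, map_add, hx, hy]
    simp [add_mul, TensorProduct.add_tmul]
    abel
  | smul c x _ hx =>
    refine TensorProduct.ext' fun a b => ?_
    rw [map_smul, map_smul, hx]
    simp [TensorProduct.smul_tmul']

/-- The second Adams operation: the convolution square of the identity of the free associative
algebra, i.e. the coproduct followed by the product. -/
def adams (deg : S → ℤ) : FreeAlgebra ℚ S →ₗ[ℚ] FreeAlgebra ℚ S :=
  LinearMap.mul' ℚ (FreeAlgebra ℚ S) ∘ₗ LinearMap.applyₗ (1 ⊗ₜ 1)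
    ∘ₗ (coproductAction deg).toLinearMap

theorem adams_apply (x : FreeAlgebra ℚ S) :
    adams deg x = LinearMap.mul' ℚ _ (coproductAction deg x (1 ⊗ₜ 1)) := rfl

theorem adams_one : adams deg 1 = 1 := by
  simp [adams_apply]

/-- The coproduct of a primitive element is `x ⊗ 1 + 1 ⊗ x`, and both terms multiply to `x`. -/
theorem adams_of_mem_liePoly {x : FreeAlgebra ℚ S} (hx : x ∈ liePoly deg A) :
    adams deg x = (2 : ℚ) • x := by
  induction hx using Submodule.span_induction with
  | mem x hx =>
    obtain ⟨m, hx⟩ := hx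
    rw [adams_apply, hx.coproductAction_tmul]
    simp [two_smul]
  | zero => simp
  | add x y _ _ hx hy => rw [map_add, hx, hy, smul_add]
  | smul c x _ hx => rw [map_smul, hx, smul_comm]

/-! ### Superderivations with Lie values are coderivations -/

/-- The action of a superderivation on the graded tensor square. -/
def tensorDerivation (deg : S → ℤ) (e : ℤ) (g : S → FreeAlgebra ℚ S) :
    Module.End ℚ (FreeAlgebra ℚ S ⊗[ℚ] FreeAlgebra ℚ S) :=
  TensorProduct.map (superderivation deg e g) LinearMap.id
    + TensorProduct.map (twist deg e).toLinearMap (superderivation deg e g)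

theorem tensorDerivation_tmul {e : ℤ} {g : S → FreeAlgebra ℚ S} (a b : FreeAlgebra ℚ S) :
    tensorDerivation deg e g (a ⊗ₜ b)
      = superderivation deg e g a ⊗ₜ b + twist deg e a ⊗ₜ superderivation deg e g b := by
  simp [tensorDerivation]

/-- This is the Leibniz rule for `D ⊗ 1 + 1 ⊗ D` on the graded tensor square. It turns the coproduct
of the generator into `g s ⊗ 1 + 1 ⊗ g s`, which is the coproduct of `g s` because `g s` is Lie and
hence primitive; the homogeneity of `g` makes the signs match. -/
theorem tensorDerivation_coproductAction_ι {e : ℤ} {g : S → FreeAlgebra ℚ S}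
    (hg : ∀ s, g s ∈ supported fun w => wordDeg deg w = deg s + e)
    (hL : ∀ s, g s ∈ liePoly deg A) (s : S) (z : FreeAlgebra ℚ S ⊗[ℚ] FreeAlgebra ℚ S) :
    tensorDerivation deg e g (coproductAction deg (FreeAlgebra.ι ℚ s) z)
      = coproductAction deg (g s) z
        + (-1 : ℚ) ^ (e * deg s) •
          coproductAction deg (FreeAlgebra.ι ℚ s) (tensorDerivation deg e g z) := by
  induction z with
  | zero => simp
  | add x y hx hy =>
    simp only [map_add, hx, hy, smul_add]
    abel
  | tmul a b =>
    rw [coproductAction_of_mem_liePoly (hL s), coproductAction_ι]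
    simp only [LinearMap.add_apply, rightAction_ι_tmul, rightAction_tmul (hg s), map_add,
      tensorDerivation_tmul, TensorProduct.map_tmul, LinearMap.mulLeft_apply, LinearMap.id_apply,
      superderivation_mul, superderivation_ι, superderivation_twist hg, twist_twist, map_mul,
      twist_ι, TensorProduct.add_tmul, TensorProduct.tmul_add, smul_mul_assoc, smul_add,
      TensorProduct.smul_tmul', TensorProduct.tmul_smul, add_comm e (deg s)]
    abel

theorem tensorDerivation_coproductAction {e : ℤ} {g : S → FreeAlgebra ℚ S}
    (hg : ∀ s, g s ∈ supported fun w => wordDeg deg w = deg s + e)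
    (hL : ∀ s, g s ∈ liePoly deg A) (x : FreeAlgebra ℚ S) :
    tensorDerivation deg e g (coproductAction deg x (1 ⊗ₜ 1))
      = coproductAction deg (superderivation deg e g x) (1 ⊗ₜ 1) := by
  have := linearMap_ext_word
    (f := tensorDerivation deg e g ∘ₗ LinearMap.applyₗ (1 ⊗ₜ 1)
      ∘ₗ (coproductAction deg).toLinearMap)
    (g := LinearMap.applyₗ (1 ⊗ₜ 1) ∘ₗ (coproductAction deg).toLinearMap
      ∘ₗ superderivation deg e g) (by
    intro w
    simp only [LinearMap.comp_apply, AlgHom.toLinearMap_apply, LinearMap.applyₗ_apply_apply]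
    induction w with
    | nil => simp [tensorDerivation_tmul]
    | cons s w ih =>
      rw [superderivation_word_cons, word_cons, map_mul, Module.End.mul_apply,
        tensorDerivation_coproductAction_ι hg hL, ih, map_add, map_smul, map_mul, map_mul]
      rfl)
  exact LinearMap.congr_fun this x

/-- A superderivation with Lie values is compatible with the coproduct, and by the Leibniz rule also
with the product, hence with their composite. -/
theorem adams_superderivation {e : ℤ} {g : S → FreeAlgebra ℚ S}
    (hg : ∀ s, g s ∈ supported fun w => wordDeg deg w = deg s + e)
    (hL : ∀ s, g s ∈ liePoly deg A) (x : FreeAlgebra ℚ S) :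
    adams deg (superderivation deg e g x) = superderivation deg e g (adams deg x) := by
  have hmul : ∀ z, LinearMap.mul' ℚ _ (tensorDerivation deg e g z)
      = superderivation deg e g (LinearMap.mul' ℚ _ z) := by
    intro z
    induction z with
    | zero => simp
    | add x y hx hy => simp only [map_add, hx, hy]
    | tmul a b => simp [tensorDerivation_tmul, superderivation_mul]
  rw [adams_apply, adams_apply, ← tensorDerivation_coproductAction hg hL, hmul]

/-- The Adams operation preserves every weight grading, because it commutes with the derivation
whose eigenspaces are the weight spaces. The weight `c` is independent of `deg`: it is taken to be
the degree in one use and the word length in another. -/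
theorem adams_mem_supported (c : S → ℤ) (p : ℤ → Prop) {x : FreeAlgebra ℚ S}
    (hx : x ∈ supported fun w => p (wordDeg c w)) :
    adams deg x ∈ supported fun w => p (wordDeg c w) := by
  -- The Euler derivation of the weight `c`: each word is an eigenvector whose eigenvalue is its
  -- weight.
  let g : S → FreeAlgebra ℚ S := fun s => (c s : ℚ) • FreeAlgebra.ι ℚ s
  have hg : ∀ s, g s ∈ supported fun w => wordDeg deg w = deg s + 0 := fun s => by
    rw [add_zero]
    exact Submodule.smul_mem _ _ (IsLieWord.gen (A := Set.univ) s (Set.mem_univ s)).mem_supported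
  have hL : ∀ s, g s ∈ liePoly deg Set.univ := fun s =>
    Submodule.smul_mem _ _ (IsLieWord.gen s (Set.mem_univ s)).mem_liePoly
  have hword : ∀ w, superderivation deg 0 g (word w) = (wordDeg c w : ℚ) • word w := by
    intro w
    induction w with
    | nil => simp [wordDeg]
    | cons s w ih =>
      rw [superderivation_word_cons, ih, wordDeg_cons, word_cons]
      simp [g, add_smul]
  have hrepr : ∀ (y : FreeAlgebra ℚ S) (u : List S),
      (wordBasis S).repr (superderivation deg 0 g y) u
        = (wordDeg c u : ℚ) * (wordBasis S).repr y u := by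
    intro y u
    have := linearMap_ext_word
      (f := Finsupp.lapply u ∘ₗ (wordBasis S).repr.toLinearMap ∘ₗ superderivation deg 0 g)
      (g := (wordDeg c u : ℚ) • Finsupp.lapply u ∘ₗ (wordBasis S).repr.toLinearMap) (by
      intro w
      simp only [LinearMap.comp_apply, LinearEquiv.coe_coe, hword, map_smul, repr_word,
        LinearMap.smul_apply, Finsupp.lapply_apply]
      by_cases h : w = u
      · rw [h]
      · simp [h])
    exact LinearMap.congr_fun this y
  suffices h : supported (fun w => p (wordDeg c w))
      ≤ (supported fun w => p (wordDeg c w)).comap (adams deg) from h hx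
  refine supported_le fun w hw => ?_
  refine supported_mono (p := fun u => wordDeg c u = wordDeg c w) (fun u hu => by rwa [hu]) ?_
  refine mem_supported_iff.2 fun u hu => ?_
  have h1 := hrepr (adams deg (word w)) u
  rw [← adams_superderivation hg hL, hword, map_smul, map_smul, Finsupp.smul_apply,
    smul_eq_mul] at h1
  have h2 : ((wordDeg c w : ℚ) - wordDeg c u) * (wordBasis S).repr (adams deg (word w)) u = 0 := by
    rw [sub_mul, h1, sub_self]
  refine (mul_eq_zero.1 h2).resolve_left fun h3 => hu ?_
  exact_mod_cast (sub_eq_zero.1 h3).symm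

end LiePoly

/-! ### The filtration by the number of Lie factors and the projection onto Lie elements -/

/-- The span of the products of at most `k` Lie polynomials. -/
def lieFiltration {S : Type*} (deg : S → ℤ) (A : Set S) (k : ℕ) : Submodule ℚ (FreeAlgebra ℚ S) :=
  (1 ⊔ liePoly deg A) ^ k

section LieFiltration

variable {S : Type*} {deg : S → ℤ} {A : Set S}

theorem lieFiltration_mono {i j : ℕ} (h : i ≤ j) : lieFiltration deg A i ≤ lieFiltration deg A j :=
  monotone_nat_of_le_succ (fun n x hx => by
    have h1 : (1 : FreeAlgebra ℚ S) ∈ 1 ⊔ liePoly deg A :=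
      Submodule.mem_sup_left (Submodule.one_le.1 le_rfl)
    have := Submodule.mul_mem_mul hx h1
    rwa [mul_one, lieFiltration, ← pow_succ] at this) h

theorem mul_mem_lieFiltration {i j : ℕ} {x y : FreeAlgebra ℚ S} (hx : x ∈ lieFiltration deg A i)
    (hy : y ∈ lieFiltration deg A j) : x * y ∈ lieFiltration deg A (i + j) := by
  rw [lieFiltration, pow_add]
  exact Submodule.mul_mem_mul hx hy

theorem one_mem_lieFiltration (k : ℕ) : (1 : FreeAlgebra ℚ S) ∈ lieFiltration deg A k :=
  lieFiltration_mono (Nat.zero_le k) (by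
    rw [lieFiltration, pow_zero]
    exact Submodule.one_le.1 le_rfl)

theorem mem_lieFiltration_one {x : FreeAlgebra ℚ S} (hx : x ∈ liePoly deg A) :
    x ∈ lieFiltration deg A 1 := by
  rw [lieFiltration, pow_one]
  exact Submodule.mem_sup_right hx

/-- Induction on products of Lie words. -/
theorem lieFiltration_induction {C : ℕ → FreeAlgebra ℚ S → Prop}
    (add : ∀ i x y, C i x → C i y → C i (x + y)) (smul : ∀ i (c : ℚ) x, C i x → C i (c • x))
    (one : C 0 1)
    (succ : ∀ i x, x ∈ lieFiltration deg A i → C i x → C (i + 1) x)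
    (mul : ∀ i m y x, IsLieWord deg A m y → x ∈ lieFiltration deg A i → C i x → C (i + 1) (y * x))
    {k : ℕ} {x : FreeAlgebra ℚ S} (hx : x ∈ lieFiltration deg A k) : C k x := by
  refine Submodule.pow_induction_on_left' (1 ⊔ liePoly deg A) (C := fun i x _ => C i x) ?_ ?_ ?_ hx
  · intro r
    rw [Algebra.algebraMap_eq_smul_one]
    exact smul _ _ _ one
  · intro x y i _ _
    exact add i x y
  · intro m hm i x hx hC
    obtain ⟨u, hu, v, hv, rfl⟩ := Submodule.mem_sup.1 hm
    obtain ⟨r, rfl⟩ := Submodule.mem_one.1 hu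
    rw [add_mul, ← Algebra.smul_def]
    refine add _ _ _ (smul _ _ _ (succ _ _ hx hC)) ?_
    clear hm
    induction hv using Submodule.span_induction with
    | mem v hv =>
      obtain ⟨n, hv⟩ := hv
      exact mul _ _ _ _ hv hx hC
    | zero =>
      rw [zero_mul, ← zero_smul ℚ x]
      exact smul _ _ _ (succ _ _ hx hC)
    | add v w _ _ hv hw =>
      rw [add_mul]
      exact add _ _ _ hv hw
    | smul c v _ hv =>
      rw [smul_mul_assoc]
      exact smul _ _ _ hv

theorem twist_mem_lieFiltration (e : ℤ) {k : ℕ} {x : FreeAlgebra ℚ S}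
    (hx : x ∈ lieFiltration deg A k) : twist deg e x ∈ lieFiltration deg A k := by
  refine lieFiltration_induction (C := fun i x => twist deg e x ∈ lieFiltration deg A i)
    ?_ ?_ ?_ ?_ ?_ hx
  · intro i x y hx hy
    rw [map_add]
    exact add_mem hx hy
  · intro i c x hx
    rw [map_smul]
    exact Submodule.smul_mem _ _ hx
  · rw [map_one]
    exact one_mem_lieFiltration 0
  · intro i x _ h
    exact lieFiltration_mono (Nat.le_succ i) h
  · intro i m y x hy _ h
    rw [map_mul, twist_of_mem_supported e hy.mem_supported, smul_mul_assoc, add_comm]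
    exact Submodule.smul_mem _ _
      (mul_mem_lieFiltration (mem_lieFiltration_one hy.mem_liePoly) h)

/-- Graded commutators with Lie words preserve the filtration. -/
theorem IsLieWord.commutator_mem_lieFiltration {m : ℤ} {y : FreeAlgebra ℚ S}
    (hy : IsLieWord deg A m y) {k : ℕ} {x : FreeAlgebra ℚ S} (hx : x ∈ lieFiltration deg A k) :
    y * x - twist deg m x * y ∈ lieFiltration deg A k := by
  refine lieFiltration_induction
    (C := fun i x => y * x - twist deg m x * y ∈ lieFiltration deg A i) ?_ ?_ ?_ ?_ ?_ hx
  · intro i x z hx hz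
    have : y * (x + z) - twist deg m (x + z) * y
        = (y * x - twist deg m x * y) + (y * z - twist deg m z * y) := by
      rw [map_add, mul_add, add_mul]
      abel
    rw [this]
    exact add_mem hx hz
  · intro i c x hx
    rw [map_smul, mul_smul_comm, smul_mul_assoc, ← smul_sub]
    exact Submodule.smul_mem _ _ hx
  · rw [map_one, mul_one, one_mul, sub_self]
    exact zero_mem _
  · intro i x _ h
    exact lieFiltration_mono (Nat.le_succ i) h
  · intro i n z x hz hx h
    -- Graded Leibniz rule for the commutator with `y`: since `[y, z]` is again a single Lie word,
    -- the number of factors does not grow.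
    have key : y * (z * x) - twist deg m (z * x) * y
        = (y * z - (-1 : ℚ) ^ (m * n) • (z * y)) * x
          + (-1 : ℚ) ^ (m * n) • (z * (y * x - twist deg m x * y)) := by
      rw [map_mul, twist_of_mem_supported m hz.mem_supported]
      simp only [sub_mul, mul_sub, smul_sub, smul_mul_assoc, mul_assoc]
      abel
    rw [key, add_comm i]
    exact add_mem
      (mul_mem_lieFiltration (mem_lieFiltration_one (hy.bracket m n y z hz).mem_liePoly) hx)
      (Submodule.smul_mem _ _ (mul_mem_lieFiltration (mem_lieFiltration_one hz.mem_liePoly) h))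

/-- The filtration of the tensor square induced by `lieFiltration`. -/
def tensorFiltration (deg : S → ℤ) (A : Set S) (k : ℕ) :
    Submodule ℚ (FreeAlgebra ℚ S ⊗[ℚ] FreeAlgebra ℚ S) :=
  Submodule.span ℚ {z | ∃ i j, i + j = k ∧ ∃ a ∈ lieFiltration deg A i,
    ∃ b ∈ lieFiltration deg A j, z = a ⊗ₜ b}

theorem tmul_mem_tensorFiltration {i j k : ℕ} (h : i + j = k) {a b : FreeAlgebra ℚ S}
    (ha : a ∈ lieFiltration deg A i) (hb : b ∈ lieFiltration deg A j) :
    a ⊗ₜ b ∈ tensorFiltration deg A k :=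
  Submodule.subset_span ⟨i, j, h, a, ha, b, hb, rfl⟩

theorem tensorFiltration_le_succ (k : ℕ) :
    tensorFiltration deg A k ≤ tensorFiltration deg A (k + 1) := by
  refine Submodule.span_le.2 ?_
  rintro _ ⟨i, j, rfl, a, ha, b, hb, rfl⟩
  exact tmul_mem_tensorFiltration (i := i) (j := j + 1) (by omega) ha
    (lieFiltration_mono (Nat.le_succ j) hb)

theorem mul'_mem_lieFiltration {k : ℕ} {z : FreeAlgebra ℚ S ⊗[ℚ] FreeAlgebra ℚ S}
    (hz : z ∈ tensorFiltration deg A k) : LinearMap.mul' ℚ _ z ∈ lieFiltration deg A k := by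
  suffices h : tensorFiltration deg A k
      ≤ (lieFiltration deg A k).comap (LinearMap.mul' ℚ (FreeAlgebra ℚ S)) from h hz
  refine Submodule.span_le.2 ?_
  rintro _ ⟨i, j, rfl, a, ha, b, hb, rfl⟩
  simpa using mul_mem_lieFiltration ha hb

theorem IsLieWord.coproductAction_mem_tensorFiltration {m : ℤ} {y : FreeAlgebra ℚ S}
    (hy : IsLieWord deg A m y) {k : ℕ} {z : FreeAlgebra ℚ S ⊗[ℚ] FreeAlgebra ℚ S}
    (hz : z ∈ tensorFiltration deg A k) :
    coproductAction deg y z ∈ tensorFiltration deg A (k + 1) := by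
  suffices h : tensorFiltration deg A k
      ≤ (tensorFiltration deg A (k + 1)).comap (coproductAction deg y) from h hz
  refine Submodule.span_le.2 ?_
  rintro _ ⟨i, j, rfl, a, ha, b, hb, rfl⟩
  have hy1 := mem_lieFiltration_one hy.mem_liePoly
  simp only [SetLike.mem_coe, Submodule.mem_comap, hy.coproductAction_tmul]
  exact add_mem
    (tmul_mem_tensorFiltration (by omega) (mul_mem_lieFiltration hy1 ha) hb)
    (tmul_mem_tensorFiltration (by omega) (twist_mem_lieFiltration m ha)
      (mul_mem_lieFiltration hy1 hb))

/-- On `a ⊗ b` the product of the two terms is `y a b ± a y b`. Moving `y` to the front in the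
second term costs a graded commutator of `y` with `a`, which does not raise the filtration. -/
theorem IsLieWord.mul'_coproductAction_sub_mem {m : ℤ} {y : FreeAlgebra ℚ S}
    (hy : IsLieWord deg A m y) {k : ℕ} {z : FreeAlgebra ℚ S ⊗[ℚ] FreeAlgebra ℚ S}
    (hz : z ∈ tensorFiltration deg A k) :
    LinearMap.mul' ℚ _ (coproductAction deg y z) - (2 : ℚ) • (y * LinearMap.mul' ℚ _ z)
      ∈ lieFiltration deg A k := by
  suffices h : tensorFiltration deg A k
      ≤ (lieFiltration deg A k).comap (LinearMap.mul' ℚ (FreeAlgebra ℚ S) ∘ₗ coproductAction deg y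
        - (2 : ℚ) • LinearMap.mulLeft ℚ y ∘ₗ LinearMap.mul' ℚ (FreeAlgebra ℚ S)) from h hz
  refine Submodule.span_le.2 ?_
  rintro _ ⟨i, j, rfl, a, ha, b, hb, rfl⟩
  have key : y * a * b + twist deg m a * (y * b) - (2 : ℚ) • (y * (a * b))
      = -((y * a - twist deg m a * y) * b) := by
    rw [two_smul, sub_mul]
    simp only [mul_assoc]
    abel
  simp only [SetLike.mem_coe, Submodule.mem_comap, LinearMap.sub_apply, LinearMap.comp_apply,
    LinearMap.smul_apply, LinearMap.mulLeft_apply, hy.coproductAction_tmul, map_add,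
    LinearMap.mul'_apply]
  rw [key]
  exact neg_mem (mul_mem_lieFiltration (hy.commutator_mem_lieFiltration ha) hb)

theorem coproductAction_one_mem_tensorFiltration {k : ℕ} {x : FreeAlgebra ℚ S}
    (hx : x ∈ lieFiltration deg A k) :
    coproductAction deg x (1 ⊗ₜ 1) ∈ tensorFiltration deg A k := by
  refine lieFiltration_induction
    (C := fun i x => coproductAction deg x (1 ⊗ₜ 1) ∈ tensorFiltration deg A i) ?_ ?_ ?_ ?_ ?_ hx
  · intro i x y hx hy
    rw [map_add]
    exact add_mem hx hy
  · intro i c x hx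
    rw [map_smul]
    exact Submodule.smul_mem _ _ hx
  · rw [map_one]
    exact tmul_mem_tensorFiltration (add_zero 0) (one_mem_lieFiltration 0) (one_mem_lieFiltration 0)
  · intro i x _ h
    exact tensorFiltration_le_succ i h
  · intro i m y x hy _ h
    rw [map_mul]
    exact hy.coproductAction_mem_tensorFiltration h

/-! ### Eigenvalues of the Adams operation and the Lie projection -/

theorem adams_mem_lieFiltration {k : ℕ} {x : FreeAlgebra ℚ S} (hx : x ∈ lieFiltration deg A k) :
    adams deg x ∈ lieFiltration deg A k :=
  mul'_mem_lieFiltration (coproductAction_one_mem_tensorFiltration hx)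

/-- On the associated graded of the filtration by the number `k` of Lie factors, the second Adams
operation is multiplication by `2 ^ k`. -/
theorem adams_sub_mem_lieFiltration {k : ℕ} {x : FreeAlgebra ℚ S}
    (hx : x ∈ lieFiltration deg A (k + 1)) :
    adams deg x - (2 : ℚ) ^ (k + 1) • x ∈ lieFiltration deg A k := by
  -- The truncated index `j - 1` lets the induction start at `j = 0`, where the difference is in
  -- fact zero on constants.
  suffices h : ∀ j, j = k + 1 → adams deg x - (2 : ℚ) ^ j • x ∈ lieFiltration deg A (j - 1) from
    h _ rfl
  intro j hj
  rw [← hj] at hx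
  clear hj
  refine lieFiltration_induction
    (C := fun j x => adams deg x - (2 : ℚ) ^ j • x ∈ lieFiltration deg A (j - 1)) ?_ ?_ ?_ ?_ ?_ hx
  · intro i x y hx hy
    have : adams deg (x + y) - (2 : ℚ) ^ i • (x + y)
        = (adams deg x - (2 : ℚ) ^ i • x) + (adams deg y - (2 : ℚ) ^ i • y) := by
      rw [map_add, smul_add]
      abel
    rw [this]
    exact add_mem hx hy
  · intro i c x hx
    rw [map_smul, smul_comm, ← smul_sub]
    exact Submodule.smul_mem _ _ hx
  · rw [adams_one, pow_zero, one_smul, sub_self]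
    exact zero_mem _
  · intro i x hx _
    exact sub_mem (adams_mem_lieFiltration hx) (Submodule.smul_mem _ _ hx)
  · intro i m y x hy hx h
    have hy1 := mem_lieFiltration_one hy.mem_liePoly
    have h1 := hy.mul'_coproductAction_sub_mem (coproductAction_one_mem_tensorFiltration hx)
    rw [← Module.End.mul_apply, ← map_mul, ← adams_apply, ← adams_apply] at h1
    have key : adams deg (y * x) - (2 : ℚ) ^ (i + 1) • (y * x)
        = (adams deg (y * x) - (2 : ℚ) • (y * adams deg x))
          + (2 : ℚ) • (y * (adams deg x - (2 : ℚ) ^ i • x)) := by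
      rw [mul_sub, smul_sub, mul_smul_comm, smul_smul, pow_succ']
      abel
    rw [key]
    refine add_mem h1 (Submodule.smul_mem _ _ ?_)
    -- For `i = 0` truncation makes the inductive bound too weak: it would only place the product in
    -- filtration 1. There `x` is a constant and the difference vanishes exactly.
    rcases i with _ | i
    · rw [lieFiltration, pow_zero] at hx
      obtain ⟨r, rfl⟩ := Submodule.mem_one.1 hx
      have : adams deg (algebraMap ℚ _ r) - (2 : ℚ) ^ 0 • algebraMap ℚ (FreeAlgebra ℚ S) r = 0 := by
        rw [Algebra.algebraMap_eq_smul_one, map_smul, adams_one, pow_zero, one_smul, sub_self]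
      rw [this, mul_zero]
      exact zero_mem _
    · have := mul_mem_lieFiltration hy1 h
      rwa [show 1 + (i + 1 - 1) = i + 1 + 1 - 1 by omega] at this

/-- The projection of products of at most `k + 1` Lie polynomials onto Lie polynomials along the
other eigenspaces of the second Adams operation. -/
def lieProjection (deg : S → ℤ) : ℕ → Module.End ℚ (FreeAlgebra ℚ S)
  | 0 => adams deg - 1
  | k + 1 => lieProjection deg k
      * ((2 - (2 : ℚ) ^ (k + 2))⁻¹ • (adams deg - (2 : ℚ) ^ (k + 2) • (1 : Module.End ℚ _)))

/-- Each factor `adams - 2 ^ j` kills the top graded piece of filtration `j`. What finally remains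
is a constant plus a Lie polynomial; `adams - 1` kills the constant and is `2 - 1 = 1` on the Lie
part. -/
theorem lieProjection_mem_liePoly {k : ℕ} {x : FreeAlgebra ℚ S}
    (hx : x ∈ lieFiltration deg A (k + 1)) : lieProjection deg k x ∈ liePoly deg A := by
  induction k generalizing x with
  | zero =>
    rw [lieFiltration, zero_add, pow_one] at hx
    obtain ⟨u, hu, v, hv, rfl⟩ := Submodule.mem_sup.1 hx
    obtain ⟨r, rfl⟩ := Submodule.mem_one.1 hu
    have : lieProjection deg 0 (algebraMap ℚ _ r + v) = v := by
      rw [lieProjection, LinearMap.sub_apply, map_add, adams_of_mem_liePoly hv,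
        Algebra.algebraMap_eq_smul_one, map_smul, adams_one, Module.End.one_apply, two_smul]
      abel
    rwa [this]
  | succ k ih =>
    exact ih (Submodule.smul_mem _ _ (adams_sub_mem_lieFiltration hx))

/-- Lie polynomials have Adams eigenvalue 2, and each factor is normalised to be 1 on that
eigenvalue. -/
theorem lieProjection_of_mem_liePoly (k : ℕ) {x : FreeAlgebra ℚ S} (hx : x ∈ liePoly deg A) :
    lieProjection deg k x = x := by
  induction k with
  | zero =>
    rw [lieProjection, LinearMap.sub_apply, adams_of_mem_liePoly hx, two_smul,
      Module.End.one_apply, add_sub_cancel_right]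
  | succ k ih =>
    have h2 : (2 : ℚ) - 2 ^ (k + 2) ≠ 0 := by
      have : (1 : ℚ) ≤ 2 ^ k := one_le_pow₀ (by norm_num)
      rw [pow_add]
      linarith
    rw [lieProjection, Module.End.mul_apply, LinearMap.smul_apply, LinearMap.sub_apply,
      adams_of_mem_liePoly hx, LinearMap.smul_apply, Module.End.one_apply, ← sub_smul,
      smul_smul, inv_mul_cancel₀ h2, one_smul, ih]

theorem lieProjection_superderivation {e : ℤ} {g : S → FreeAlgebra ℚ S}
    (hg : ∀ s, g s ∈ supported fun w => wordDeg deg w = deg s + e)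
    (hL : ∀ s, g s ∈ liePoly deg A) (k : ℕ) (x : FreeAlgebra ℚ S) :
    lieProjection deg k (superderivation deg e g x)
      = superderivation deg e g (lieProjection deg k x) := by
  induction k generalizing x with
  | zero => simp [lieProjection, adams_superderivation hg hL]
  | succ k ih => simp [lieProjection, adams_superderivation hg hL, ih]

theorem lieProjection_mem_supported (c : S → ℤ) (p : ℤ → Prop) (k : ℕ) {x : FreeAlgebra ℚ S}
    (hx : x ∈ supported fun w => p (wordDeg c w)) :
    lieProjection deg k x ∈ supported fun w => p (wordDeg c w) := by
  induction k generalizing x with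
  | zero => exact sub_mem (adams_mem_supported c p hx) hx
  | succ k ih =>
    exact ih (Submodule.smul_mem _ _
      (sub_mem (adams_mem_supported c p hx) (Submodule.smul_mem _ _ hx)))

end LieFiltration

/-! ### Polynomials as power series -/

/-- A noncommutative polynomial, as a noncommutative power series. -/
def toSeries (S : Type*) : FreeAlgebra ℚ S →ₗ[ℚ] Series S where
  toFun x := (wordBasis S).repr x
  map_add' x y := by simp
  map_smul' c x := by
    funext w
    simp

section ToSeries

variable {S : Type*} {deg : S → ℤ} {A : Set S}

theorem toSeries_apply (x : FreeAlgebra ℚ S) (w : List S) :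
    toSeries S x w = (wordBasis S).repr x w := rfl

open Classical in
theorem toSeries_word (u w : List S) : toSeries S (word u) w = if u = w then 1 else 0 := by
  rw [toSeries_apply, repr_word, Finsupp.single_apply]

theorem toSeries_ι (s : S) : toSeries S (FreeAlgebra.ι ℚ s) = gen s := by
  classical
  funext w
  rw [← word_singleton, toSeries_word, gen, Pi.single_apply]
  simp only [eq_comm]

theorem mem_supported_iff_toSeries {p : List S → Prop} {x : FreeAlgebra ℚ S} :
    x ∈ supported p ↔ ∀ w, ¬ p w → toSeries S x w = 0 :=
  mem_supported_iff

theorem word_induction {C : FreeAlgebra ℚ S → Prop} (zero : C 0)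
    (add : ∀ x y, C x → C y → C (x + y)) (smul : ∀ (c : ℚ) x, C x → C (c • x))
    (word : ∀ w, C (word w)) (x : FreeAlgebra ℚ S) : C x := by
  refine Submodule.span_induction ?_ zero (fun x y _ _ => add x y) (fun c x _ => smul c x)
    (mem_supported_true x)
  rintro _ ⟨w, -, rfl⟩
  exact word w

theorem toSeries_mul (x y : FreeAlgebra ℚ S) (w : List S) :
    toSeries S (x * y) w = ∑ i ∈ Finset.range (w.length + 1),
      toSeries S x (w.take i) * toSeries S y (w.drop i) := by
  classical
  induction x using word_induction with
  | zero => simp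
  | add x x' hx hx' => simp [add_mul, hx, hx', Finset.sum_add_distrib]
  | smul c x hx => simp [hx, Finset.mul_sum, mul_assoc]
  | word u =>
    induction y using word_induction with
    | zero => simp
    | add y y' hy hy' => simp [mul_add, hy, hy', Finset.sum_add_distrib]
    | smul c y hy => simp [hy, Finset.mul_sum, mul_left_comm]
    | word v =>
      rw [← word_append]
      simp only [toSeries_word]
      by_cases h : u ++ v = w
      · subst h
        rw [Finset.sum_eq_single u.length]
        · simp
        · intro i hi hne
          have : u ≠ (u ++ v).take i := by
            intro h
            have := congrArg List.length h
            rw [List.length_take] at this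
            rw [Finset.mem_range] at hi
            omega
          rw [if_neg this, zero_mul]
        · intro h
          exact absurd (Finset.mem_range.2 (by rw [List.length_append]; omega)) h
      · rw [if_neg h, eq_comm]
        refine Finset.sum_eq_zero fun i _ => ?_
        by_cases h1 : u = w.take i
        · by_cases h2 : v = w.drop i
          · exact absurd (by rw [h1, h2, List.take_append_drop]) h
          · rw [if_neg h2, mul_zero]
        · rw [if_neg h1, zero_mul]

/-- The sign in `bracket` depends on where the word is cut, but for homogeneous `x` and `y` only
cuts into pieces of the prescribed degrees contribute, so it is constant on the nonzero terms. -/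
theorem toSeries_bracket {m n : ℤ} {x y : FreeAlgebra ℚ S}
    (hx : x ∈ supported fun w => wordDeg deg w = m)
    (hy : y ∈ supported fun w => wordDeg deg w = n) :
    toSeries S (x * y - (-1 : ℚ) ^ (m * n) • (y * x))
      = bracket deg (toSeries S x) (toSeries S y) := by
  funext w
  rw [map_sub, map_smul, Pi.sub_apply, Pi.smul_apply, toSeries_mul, toSeries_mul, bracket,
    smul_eq_mul, Finset.mul_sum, ← Finset.sum_sub_distrib]
  refine Finset.sum_congr rfl fun i _ => ?_
  congr 1
  by_cases h1 : wordDeg deg (w.take i) = n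
  · by_cases h2 : wordDeg deg (w.drop i) = m
    · rw [h1, h2, mul_comm n m]
    · rw [mem_supported_iff_toSeries.1 hx _ h2]
      simp
  · rw [mem_supported_iff_toSeries.1 hy _ h1]
    simp

theorem IsLieWord.isLieMonomial {m : ℤ} {x : FreeAlgebra ℚ S} (hx : IsLieWord deg A m x) :
    IsLieMonomial deg A (toSeries S x) := by
  induction hx with
  | gen s hs =>
    rw [toSeries_ι]
    exact IsLieMonomial.gen s hs
  | bracket m n x y hx hy ihx ihy =>
    rw [toSeries_bracket hx.mem_supported hy.mem_supported]
    exact IsLieMonomial.bracket _ _ ihx ihy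

theorem exists_isLieWord {f : Series S} (hf : IsLieMonomial deg A f) :
    ∃ m x, IsLieWord deg A m x ∧ toSeries S x = f := by
  induction hf with
  | gen s hs => exact ⟨_, _, IsLieWord.gen s hs, toSeries_ι s⟩
  | bracket f g _ _ ihf ihg =>
    obtain ⟨m, x, hx, rfl⟩ := ihf
    obtain ⟨n, y, hy, rfl⟩ := ihg
    exact ⟨_, _, IsLieWord.bracket m n x y hx hy,
      toSeries_bracket hx.mem_supported hy.mem_supported⟩

theorem map_toSeries_liePoly : (liePoly deg A).map (toSeries S) = freeLie deg A := by
  rw [liePoly, freeLie, Submodule.map_span]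
  congr 1
  ext f
  constructor
  · rintro ⟨x, ⟨m, hx⟩, rfl⟩
    exact hx.isLieMonomial
  · intro hf
    obtain ⟨m, x, hx, rfl⟩ := exists_isLieWord hf
    exact ⟨x, ⟨m, hx⟩, rfl⟩

theorem toSeries_mem_freeLie {x : FreeAlgebra ℚ S} (hx : x ∈ liePoly deg A) :
    toSeries S x ∈ freeLie deg A := by
  rw [← map_toSeries_liePoly]
  exact Submodule.mem_map_of_mem hx

theorem toSeries_mem_completedFreeLie {x : FreeAlgebra ℚ S} (hx : x ∈ liePoly deg A) :
    toSeries S x ∈ completedFreeLie deg A :=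
  freeLie_le_completedFreeLie deg A (toSeries_mem_freeLie hx)

/-- A series in the completed free Lie algebra is approximated by Lie polynomials. -/
theorem exists_liePoly_eq {f : Series S} (hf : f ∈ completedFreeLie deg A) (N : ℕ) :
    ∃ x ∈ liePoly deg A,
      ∀ w : List S, toSeries S x w = if w.length ≤ N then f w else 0 := by
  have h : ∑ i ∈ Finset.range (N + 1), lengthPart i f ∈ freeLie deg A :=
    Submodule.sum_mem _ fun i _ => hf i
  rw [← map_toSeries_liePoly] at h
  obtain ⟨x, hx, hxf⟩ := h
  refine ⟨x, hx, fun w => ?_⟩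
  rw [hxf]
  simp only [Finset.sum_apply, lengthPart, LinearMap.coe_mk, AddHom.coe_mk]
  rw [Finset.sum_ite_eq]
  simp only [Finset.mem_range, Nat.lt_succ_iff]

theorem IsLieWord.mem_supported_letters {m : ℤ} {x : FreeAlgebra ℚ S}
    (hx : IsLieWord deg A m x) : x ∈ supported fun w => w ≠ [] ∧ ∀ s ∈ w, s ∈ A := by
  induction hx with
  | gen s hs =>
    rw [← word_singleton]
    exact word_mem_supported (by simpa using hs)
  | bracket m n x y _ _ hx hy =>
    have h : ∀ u v : List S, (u ≠ [] ∧ ∀ s ∈ u, s ∈ A) → (v ≠ [] ∧ ∀ s ∈ v, s ∈ A) →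
        (u ++ v ≠ [] ∧ ∀ s ∈ u ++ v, s ∈ A) := by
      intro u v hu hv
      refine ⟨by simp [hu.1], fun s hs => ?_⟩
      rcases List.mem_append.1 hs with hs | hs
      exacts [hu.2 s hs, hv.2 s hs]
    exact sub_mem (mul_mem_supported h hx hy)
      (Submodule.smul_mem _ _ (mul_mem_supported h hy hx))

theorem liePoly_le_supported :
    liePoly deg A ≤ supported fun w => w ≠ [] ∧ ∀ s ∈ w, s ∈ A := by
  refine Submodule.span_le.2 ?_
  rintro x ⟨m, hx⟩
  exact hx.mem_supported_letters

theorem liePoly_mono {B : Set S} (h : A ⊆ B) : liePoly deg A ≤ liePoly deg B := by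
  refine Submodule.span_mono ?_
  rintro x ⟨m, hx⟩
  refine ⟨m, ?_⟩
  induction hx with
  | gen s hs => exact IsLieWord.gen s (h hs)
  | bracket m n x y _ _ ihx ihy => exact IsLieWord.bracket m n x y ihx ihy

theorem completedFreeLie_apply_eq_zero {f : Series S} (hf : f ∈ completedFreeLie deg A)
    {w : List S} {s : S} (hs : s ∈ w) (hsA : s ∉ A) : f w = 0 := by
  obtain ⟨x, hx, hxf⟩ := exists_liePoly_eq hf w.length
  have h := mem_supported_iff_toSeries.1 (liePoly_le_supported hx) w (fun h => hsA (h.2 s hs))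
  rw [hxf] at h
  simpa using h

theorem completedFreeLie_apply_nil {f : Series S} (hf : f ∈ completedFreeLie deg A) :
    f [] = 0 := by
  obtain ⟨x, hx, hxf⟩ := exists_liePoly_eq hf 0
  have h := mem_supported_iff_toSeries.1 (liePoly_le_supported hx) [] (by simp)
  rw [hxf] at h
  simpa using h

/-- Letters are themselves Lie, so bounding the length of a polynomial places it in the domain where
`lieProjection` has Lie values. -/
theorem word_mem_lieFiltration {w : List S} (hw : ∀ s ∈ w, s ∈ A) :
    word w ∈ lieFiltration deg A w.length := by
  induction w with
  | nil => exact one_mem_lieFiltration 0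
  | cons s w ih =>
    rw [word_cons, List.length_cons, add_comm]
    exact mul_mem_lieFiltration
      (mem_lieFiltration_one (IsLieWord.gen s (hw s (by simp))).mem_liePoly)
      (ih fun t ht => hw t (by simp [ht]))

/-! ### Truncating the differential to a superderivation of polynomials -/

theorem bracket_congr {f f' g g' : Series S} {N : ℕ}
    (hf : ∀ w : List S, w.length ≤ N → f w = f' w) (hg : ∀ w : List S, w.length ≤ N → g w = g' w)
    {w : List S} (hw : w.length ≤ N) : bracket deg f g w = bracket deg f' g' w := by
  refine Finset.sum_congr rfl fun i _ => ?_
  have h1 : (w.take i).length ≤ N := by rw [List.length_take]; omega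
  have h2 : (w.drop i).length ≤ N := by rw [List.length_drop]; omega
  rw [hf _ h1, hf _ h2, hg _ h1, hg _ h2]

theorem superderivation_mem_supported {e : ℤ} {g : S → FreeAlgebra ℚ S}
    (hg : ∀ s, g s ∈ supported fun w => wordDeg deg w = deg s + e) {m : ℤ} {x : FreeAlgebra ℚ S}
    (hx : x ∈ supported fun w => wordDeg deg w = m) :
    superderivation deg e g x ∈ supported fun w => wordDeg deg w = m + e := by
  suffices h : ∀ w, superderivation deg e g (word w)
      ∈ supported fun u => wordDeg deg u = wordDeg deg w + e by
    refine supported_le (N := (supported _).comap (superderivation deg e g)) ?_ hx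
    rintro w rfl
    exact h w
  intro w
  induction w with
  | nil =>
    rw [word_nil, superderivation_one]
    exact zero_mem _
  | cons s w ih =>
    rw [superderivation_word_cons]
    have hs : FreeAlgebra.ι ℚ s ∈ supported fun w => wordDeg deg w = deg s :=
      (IsLieWord.gen (A := Set.univ) s (Set.mem_univ s)).mem_supported
    have hw : word w ∈ supported fun u => wordDeg deg u = wordDeg deg w := word_mem_supported rfl
    refine add_mem (mul_mem_supported ?_ (hg s) hw)
      (Submodule.smul_mem _ _ (mul_mem_supported ?_ hs ih))
    · intro u v hu hv
      rw [wordDeg_append, hu, hv, wordDeg_cons]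
      ring
    · intro u v hu hv
      rw [wordDeg_append, hu, hv, wordDeg_cons]
      ring

/-- The differential of a free cDGL agrees on Lie polynomials, up to words of length greater than
`N`, with any superderivation which agrees with it in this sense on the generators. -/
theorem FreeCDGL.d_eq_superderivation (L : FreeCDGL deg) {N : ℕ} {g : S → FreeAlgebra ℚ S}
    (hg : ∀ s, g s ∈ supported fun w => wordDeg deg w = deg s + -1)
    (hgd : ∀ s, ∀ w : List S, w.length ≤ N →
      (L.d (ofGen deg s) : Series S) w = toSeries S (g s) w)
    {x : FreeAlgebra ℚ S} (hx : x ∈ liePoly deg Set.univ)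
    (hx' : toSeries S x ∈ completedFreeLie deg Set.univ) {w : List S} (hw : w.length ≤ N) :
    (L.d ⟨toSeries S x, hx'⟩ : Series S) w = toSeries S (superderivation deg (-1) g x) w := by
  induction hx using Submodule.span_induction generalizing w with
  | zero =>
    have : (⟨toSeries S 0, hx'⟩ : CompletedFreeLie deg) = 0 := Subtype.ext (map_zero _)
    rw [this]
    simp
  | add x y hx hy ihx ihy =>
    have : (⟨toSeries S (x + y), hx'⟩ : CompletedFreeLie deg)
        = ⟨toSeries S x, toSeries_mem_completedFreeLie hx⟩
          + ⟨toSeries S y, toSeries_mem_completedFreeLie hy⟩ := Subtype.ext (map_add _ _ _)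
    rw [this, map_add, map_add, map_add, Submodule.coe_add, Pi.add_apply, Pi.add_apply,
      ihx _ hw, ihy _ hw]
  | smul c x hx ihx =>
    have : (⟨toSeries S (c • x), hx'⟩ : CompletedFreeLie deg)
        = c • ⟨toSeries S x, toSeries_mem_completedFreeLie hx⟩ := Subtype.ext (map_smul _ _ _)
    rw [this, map_smul, map_smul, map_smul, Submodule.coe_smul, Pi.smul_apply, Pi.smul_apply,
      ihx _ hw]
  | mem x hx =>
    obtain ⟨m, hx⟩ := hx
    induction hx generalizing w with
    | gen s _ =>
      have : (⟨toSeries S (FreeAlgebra.ι ℚ s), hx'⟩ : CompletedFreeLie deg) = ofGen deg s :=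
        Subtype.ext (toSeries_ι s)
      rw [this, superderivation_ι, hgd s w hw]
    | bracket m n x y hx hy ihx ihy =>
      have hxs := hx.mem_supported
      have hys := hy.mem_supported
      have hxc := toSeries_mem_completedFreeLie hx.mem_liePoly
      have hyc := toSeries_mem_completedFreeLie hy.mem_liePoly
      have e1 : (⟨toSeries S (x * y - (-1 : ℚ) ^ (m * n) • (y * x)), hx'⟩ : CompletedFreeLie deg)
          = lie ⟨toSeries S x, hxc⟩ ⟨toSeries S y, hyc⟩ :=
        Subtype.ext (toSeries_bracket hxs hys)
      -- The associative Leibniz rule regroups into two graded commutators, in which the derived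
      -- entry has degree one lower; this matches the Lie derivation rule for `L.d`.
      have e2 : superderivation deg (-1) g (x * y - (-1 : ℚ) ^ (m * n) • (y * x))
          = (superderivation deg (-1) g x * y
              - (-1 : ℚ) ^ ((m + -1) * n) • (y * superderivation deg (-1) g x))
            + (-1 : ℚ) ^ m • (x * superderivation deg (-1) g y
              - (-1 : ℚ) ^ (m * (n + -1)) • (superderivation deg (-1) g y * x)) := by
        rw [map_sub, map_smul, superderivation_mul, superderivation_mul,
          twist_of_mem_supported _ hxs, twist_of_mem_supported _ hys]
        have hs : ∀ a : ℤ, (-1 : ℚ) ^ (-1 * a) = (-1) ^ a := fun a => by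
          rw [neg_one_mul, zpow_neg, ← inv_zpow]
          norm_num
        rw [add_mul, mul_add m n, neg_one_zpow_add, neg_one_zpow_add, hs, hs, mul_comm m (-1), hs]
        simp only [smul_add, smul_sub, smul_mul_assoc, smul_smul]
        rw [mul_left_comm, neg_one_zpow_mul_self, mul_one]
        abel
      rw [e1, L.d_lie m ⟨toSeries S x, hxc⟩ _ (mem_supported_iff_toSeries.1 hxs), e2, map_add,
        map_smul, toSeries_bracket (superderivation_mem_supported hg hxs) hys,
        toSeries_bracket hxs (superderivation_mem_supported hg hys)]
      rw [Submodule.coe_add, Submodule.coe_smul, Pi.add_apply, Pi.add_apply, Pi.smul_apply,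
        Pi.smul_apply]
      congr 1
      · exact bracket_congr (fun w hw => ihx hxc hw) (fun _ _ => rfl) hw
      · congr 1
        exact bracket_congr (fun _ _ => rfl) (fun w hw => ihy hyc hw) hw

end ToSeries

/-! ### Contracting the first letter -/

/-- The value on a word of the contraction of the first letter with a linear form. -/
def contractionWord {S : Type*} (ε : S → ℚ) : List S → FreeAlgebra ℚ S
  | [] => 0
  | s :: w => ε s • word w

/-- The contraction of the first letter with the linear form `ε`. -/
def contraction {S : Type*} (ε : S → ℚ) : FreeAlgebra ℚ S →ₗ[ℚ] FreeAlgebra ℚ S :=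
  wordLift (contractionWord ε)

section Contraction

variable {S : Type*} {deg : S → ℤ} {A : Set S} {ε : S → ℚ}

theorem contraction_word_cons (s : S) (w : List S) :
    contraction ε (word (s :: w)) = ε s • word w := by
  rw [contraction, wordLift_word]; rfl

theorem contraction_ι_mul (s : S) (x : FreeAlgebra ℚ S) :
    contraction ε (FreeAlgebra.ι ℚ s * x) = ε s • x := by
  induction x using word_induction with
  | zero => simp
  | add x y hx hy => rw [mul_add, map_add, hx, hy, smul_add]
  | smul c x hx => rw [mul_smul_comm, map_smul, hx, smul_comm]
  | word w => rw [← word_cons, contraction_word_cons]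

/-- Without a constant term in `x`, the first letter of every word of the product comes from `x`. -/
theorem contraction_mul {x : FreeAlgebra ℚ S} (hx : x ∈ supported fun w => w ≠ [])
    (y : FreeAlgebra ℚ S) : contraction ε (x * y) = contraction ε x * y := by
  induction hx using Submodule.span_induction with
  | mem x hx =>
    obtain ⟨w, hw, rfl⟩ := hx
    obtain ⟨s, w, rfl⟩ := List.exists_cons_of_ne_nil hw
    rw [word_cons, mul_assoc, contraction_ι_mul, contraction_ι_mul, smul_mul_assoc]
  | zero => simp
  | add x y _ _ hx hy => rw [add_mul, map_add, hx, hy, map_add, add_mul]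
  | smul c x _ hx => rw [smul_mul_assoc, map_smul, hx, map_smul, smul_mul_assoc]

theorem contraction_mem_supported {p q : List S → Prop}
    (h : ∀ s w, ε s ≠ 0 → p (s :: w) → q w) {x : FreeAlgebra ℚ S} (hx : x ∈ supported p) :
    contraction ε x ∈ supported q := by
  refine supported_le (N := (supported q).comap (contraction ε)) ?_ hx
  rintro (_ | ⟨s, w⟩) hw
  · rw [Submodule.mem_comap, contraction, wordLift_word]
    exact zero_mem _
  · rw [Submodule.mem_comap, contraction_word_cons]
    by_cases hs : ε s = 0
    · rw [hs, zero_smul]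
      exact zero_mem _
    · exact Submodule.smul_mem _ _ (word_mem_supported (h s w hs hw))

theorem toSeries_contraction [Fintype S] (x : FreeAlgebra ℚ S) (w : List S) :
    toSeries S (contraction ε x) w = ∑ a, ε a * toSeries S x (a :: w) := by
  classical
  induction x using word_induction with
  | zero => simp
  | add x y hx hy => simp [hx, hy, mul_add, Finset.sum_add_distrib]
  | smul c x hx => simp [hx, Finset.mul_sum, mul_left_comm]
  | word u =>
    rcases u with _ | ⟨s, u⟩
    · rw [contraction, wordLift_word, contractionWord]
      simp only [toSeries_word]
      simp
    · rw [contraction_word_cons, map_smul, Pi.smul_apply, toSeries_word]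
      simp [toSeries_word, ite_and]

/-- The superderivation of degree `-1` and the contraction with a linear form of degree `1`
anticommute up to the contraction of the derivative of the first letter. -/
theorem contraction_superderivation (hε : ∀ s, ε s ≠ 0 → deg s = -1) {g : S → FreeAlgebra ℚ S}
    (hg : ∀ s, g s ∈ supported fun w => w ≠ []) (s : S) (w : List S) :
    superderivation deg (-1) g (contraction ε (word (s :: w)))
      + contraction ε (superderivation deg (-1) g (word (s :: w)))
      = contraction ε (g s) * word w := by
  rw [superderivation_word_cons, map_add, contraction_mul (hg s), map_smul, contraction_ι_mul,
    contraction_word_cons, map_smul]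
  by_cases hs : ε s = 0
  · simp [hs]
  · rw [hε s hs]
    norm_num

end Contraction

/-! ### Acyclicity -/

section Acyclic

variable {S : Type*} {deg : S → ℤ} {A : Set S} {ε : S → ℚ}

theorem mem_supported_and {p q : List S → Prop} {x : FreeAlgebra ℚ S} (hp : x ∈ supported p)
    (hq : x ∈ supported q) : x ∈ supported fun w => p w ∧ q w := by
  rw [mem_supported_iff] at *
  intro w hw
  by_cases h : p w
  · exact hq w fun h' => hw ⟨h, h'⟩
  · exact hp w h

theorem wordDeg_one (w : List S) : wordDeg (fun _ => 1) w = w.length := by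
  simp [wordDeg]

theorem lieProjection_mem_supported_length (k j : ℕ) {x : FreeAlgebra ℚ S}
    (hx : x ∈ supported fun w => j ≤ w.length) :
    lieProjection deg k x ∈ supported fun w => j ≤ w.length := by
  have h := lieProjection_mem_supported (deg := deg) (fun _ : S => 1) (fun z => (j : ℤ) ≤ z) k
    (x := x) (by simpa only [wordDeg_one, Nat.cast_le] using hx)
  simpa only [wordDeg_one, Nat.cast_le] using h

/-- The differential of a free cDGL on the generators is approximated by Lie polynomials. -/
theorem FreeCDGL.exists_approx_d_gen (L : FreeCDGL deg) (N : ℕ) :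
    ∃ g : S → FreeAlgebra ℚ S, (∀ s, g s ∈ liePoly deg Set.univ) ∧
      (∀ s, g s ∈ supported fun w => wordDeg deg w = deg s + -1) ∧
      (∀ s, g s ∈ supported fun w => w ≠ []) ∧
      ∀ s, ∀ w : List S, w.length ≤ N →
        (L.d (ofGen deg s) : Series S) w = toSeries S (g s) w := by
  choose g hgL hg using fun s => exists_liePoly_eq (L.d (ofGen deg s)).2 N
  refine ⟨g, hgL, fun s => ?_, fun s => ?_, fun s w hw => ?_⟩
  · refine mem_supported_iff_toSeries.2 fun w hw => ?_
    have hs : (ofGen deg s : Series S) ∈ homogeneous deg (deg s) := by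
      have := (IsLieWord.gen (deg := deg) (A := Set.univ) s (Set.mem_univ s)).mem_supported
      have := mem_supported_iff_toSeries.1 this
      rwa [toSeries_ι] at this
    rw [hg, L.d_degree _ _ hs w hw, ite_self]
  · exact supported_mono (fun _ h => h.1) (liePoly_le_supported (hgL s))
  · rw [hg, if_pos hw]

/-- If contracting the first letter of the linear part of the differential gives zero, and
contracting the first letter of its quadratic part gives minus the identity, then every cycle is a
boundary up to words of greater length. -/
theorem FreeCDGL.exists_approx_d_eq [Fintype S] (L : FreeCDGL deg)
    (hε : ∀ s, ε s ≠ 0 → deg s = -1)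
    (hlin : ∀ s, ∑ a, ε a * (L.d (ofGen deg s) : Series S) [a] = 0)
    (hquad : ∀ s t, ∑ a, ε a * (L.d (ofGen deg s) : Series S) [a, t] = - gen s [t])
    {k : ℤ} {j : ℕ} (x : CompletedFreeLie deg) (hx : (x : Series S) ∈ degreePart deg A k)
    (hdx : L.d x = 0) (hj : ∀ w : List S, w.length ≤ j → (x : Series S) w = 0) :
    ∃ y : CompletedFreeLie deg, (y : Series S) ∈ degreePart deg A (k + 1) ∧
      (∀ w : List S, w.length < j → (y : Series S) w = 0) ∧
      ∀ w : List S, w.length ≤ j + 1 → (L.d y : Series S) w = (x : Series S) w := by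
  -- Agreement up to length `j + 2` leaves `δ t` in length at least `j + 3`, so that its
  -- contraction, one letter shorter, still has length at least `j + 2`. It also covers the linear
  -- and quadratic parts of the differential, even for `j = 0`.
  obtain ⟨g, hgL, hgdeg, hgne, hgd⟩ := L.exists_approx_d_gen (j + 2)
  let δ := superderivation deg (-1) g
  let h := contraction ε
  let P := lieProjection deg (j + 1)
  obtain ⟨t, htL, ht⟩ := exists_liePoly_eq hx.1 (j + 2)
  have htU : t ∈ liePoly deg Set.univ := liePoly_mono (Set.subset_univ A) htL
  have htlow : t ∈ supported fun w => j + 1 ≤ w.length := by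
    refine mem_supported_iff_toSeries.2 fun w hw => ?_
    rw [ht, hj w (by omega), ite_self]
  have hthigh : t ∈ supported fun w => w.length ≤ j + 2 := by
    refine mem_supported_iff_toSeries.2 fun w hw => ?_
    rw [ht, if_neg hw]
  have htdeg : t ∈ supported fun w => wordDeg deg w = k := by
    refine mem_supported_iff_toSeries.2 fun w hw => ?_
    rw [ht, hx.2 w hw, ite_self]
  have htc := toSeries_mem_completedFreeLie htU
  -- the derivative of `t` vanishes up to length `j + 2`
  have hδt : δ t ∈ supported fun w => j + 3 ≤ w.length := by
    refine mem_supported_iff_toSeries.2 fun w hw => ?_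
    have hw' : w.length ≤ j + 2 := by omega
    rw [← L.d_eq_superderivation hgdeg hgd htU htc hw']
    have h0 := L.d_filtration (j + 2) (x - ⟨toSeries S t, htc⟩) (by
      intro u hu
      rw [Submodule.coe_sub, Pi.sub_apply, sub_eq_zero]
      exact ((ht u).trans (if_pos hu)).symm) w hw'
    rw [map_sub, hdx, zero_sub, Submodule.coe_neg, Pi.neg_apply, neg_eq_zero] at h0
    exact h0
  have hhδt : h (δ t) ∈ supported fun w => j + 2 ≤ w.length :=
    contraction_mem_supported (fun s w _ hw => by simpa using hw) hδt
  have hgen : ∀ s, h (g s) + FreeAlgebra.ι ℚ s ∈ supported fun w => 2 ≤ w.length := by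
    intro s
    refine mem_supported_iff_toSeries.2 fun w hw => ?_
    rw [map_add, Pi.add_apply, toSeries_contraction, toSeries_ι]
    rcases w with _ | ⟨a, _ | ⟨b, w⟩⟩
    · have : ∀ a, toSeries S (g s) [a] = (L.d (ofGen deg s) : Series S) [a] := fun a =>
        (hgd s _ (by simp)).symm
      simp only [this, hlin]
      simp [gen]
    · have : ∀ b, toSeries S (g s) [b, a] = (L.d (ofGen deg s) : Series S) [b, a] := fun a =>
        (hgd s _ (by simp)).symm
      simp only [this, hquad, neg_add_cancel]
    · simp at hw
  -- On a word `s w` the left side is `(h (g s) + s) w`, and the first factor has length at least 2,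
  -- so the word gets strictly longer.
  have hhom : δ (h t) + h (δ t) + t ∈ supported fun w => j + 2 ≤ w.length := by
    refine supported_le (N := (supported fun w => j + 2 ≤ w.length).comap
      (δ ∘ₗ h + h ∘ₗ δ + LinearMap.id)) ?_ htlow
    rintro (_ | ⟨s, w⟩) hw
    · simp at hw
    · simp only [Submodule.mem_comap, LinearMap.add_apply, LinearMap.comp_apply,
        LinearMap.id_apply]
      rw [contraction_superderivation hε hgne, word_cons, ← add_mul]
      refine mul_mem_supported ?_ (hgen s) (word_mem_supported (p := fun u => u = w) rfl)
      rintro u v hu rfl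
      rw [List.length_append]
      rw [List.length_cons] at hw
      omega
  have hht : h t ∈ lieFiltration deg A (j + 1 + 1) := by
    have h1 : h t ∈ supported fun w => (∀ s ∈ w, s ∈ A) ∧ w.length ≤ j + 2 :=
      contraction_mem_supported (p := fun w => (w ≠ [] ∧ ∀ s ∈ w, s ∈ A) ∧ w.length ≤ j + 2)
        (fun s w _ hw => ⟨fun a ha => hw.1.2 a (by simp [ha]), by
          have := hw.2
          rw [List.length_cons] at this
          omega⟩)
        (mem_supported_and (liePoly_le_supported htL) hthigh)
    refine supported_le (fun w hw => ?_) h1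
    exact lieFiltration_mono hw.2 (word_mem_lieFiltration hw.1)
  -- The contracting homotopy is `-h`, corrected to have Lie values; `P` commutes with `δ` and fixes
  -- `t`, so the homotopy identity survives the projection.
  let y := -P (h t)
  have hyL : y ∈ liePoly deg A := neg_mem (lieProjection_mem_liePoly hht)
  have hyc := toSeries_mem_completedFreeLie hyL
  have hyU : y ∈ liePoly deg Set.univ := liePoly_mono (Set.subset_univ A) hyL
  have hydeg : y ∈ supported fun w => wordDeg deg w = k + 1 := by
    refine neg_mem (lieProjection_mem_supported deg (fun z => z = k + 1) _ ?_)
    refine contraction_mem_supported (fun s w hs hw => ?_) htdeg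
    rw [wordDeg_cons, hε s hs] at hw
    omega
  have hylow : y ∈ supported fun w => j ≤ w.length :=
    neg_mem (lieProjection_mem_supported_length _ _
      (contraction_mem_supported (fun s w _ hw => by simpa using hw) htlow))
  have hδy : δ y - t ∈ supported fun w => j + 2 ≤ w.length := by
    have e : δ y - t = P (h (δ t) - (δ (h t) + h (δ t) + t)) := by
      have e1 : P (δ (h t)) = δ (P (h t)) := lieProjection_superderivation hgdeg hgL _ _
      have e2 : P t = t := lieProjection_of_mem_liePoly _ htL
      rw [map_sub, map_add, map_add, e1, e2]
      simp only [y, map_neg]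
      abel
    rw [e]
    exact lieProjection_mem_supported_length _ _ (sub_mem hhδt hhom)
  refine ⟨⟨toSeries S y, completedFreeLie_mono (Set.subset_univ A) hyc⟩,
    ⟨hyc, mem_supported_iff_toSeries.1 hydeg⟩, fun w hw => ?_, fun w hw => ?_⟩
  · exact mem_supported_iff_toSeries.1 hylow w (by omega)
  · rw [L.d_eq_superderivation hgdeg hgd hyU _ (show w.length ≤ j + 2 by omega)]
    have h0 := mem_supported_iff_toSeries.1 hδy w (by omega)
    rw [map_sub, Pi.sub_apply, sub_eq_zero] at h0
    rw [h0, ht, if_pos (by omega)]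

/-- Under the same hypotheses every cycle is a boundary. -/
theorem FreeCDGL.exists_d_eq [Fintype S] (L : FreeCDGL deg)
    (hε : ∀ s, ε s ≠ 0 → deg s = -1)
    (hlin : ∀ s, ∑ a, ε a * (L.d (ofGen deg s) : Series S) [a] = 0)
    (hquad : ∀ s t, ∑ a, ε a * (L.d (ofGen deg s) : Series S) [a, t] = - gen s [t])
    (hA : ∀ s ∈ A, (L.d (ofGen deg s) : Series S) ∈ completedFreeLie deg A)
    {k : ℤ} (x : CompletedFreeLie deg) (hx : (x : Series S) ∈ degreePart deg A k)
    (hdx : L.d x = 0) :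
    ∃ y : CompletedFreeLie deg, (y : Series S) ∈ degreePart deg A (k + 1) ∧ L.d y = x := by
  let Q : ℕ → CompletedFreeLie deg → Prop := fun j z => (z : Series S) ∈ degreePart deg A k ∧
    L.d z = 0 ∧ ∀ w : List S, w.length ≤ j → (z : Series S) w = 0
  have step : ∀ (j : ℕ) (z : {z // Q j z}), ∃ y : CompletedFreeLie deg,
      (y : Series S) ∈ degreePart deg A (k + 1) ∧
      (∀ w : List S, w.length < j → (y : Series S) w = 0) ∧ Q (j + 1) (z - L.d y) := by
    rintro j ⟨z, hz, hdz, hzj⟩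
    obtain ⟨y, hy, hyj, hdy⟩ := L.exists_approx_d_eq hε hlin hquad z hz hdz hzj
    refine ⟨y, hy, hyj, ?_, ?_, ?_⟩
    · refine sub_mem hz ⟨L.d_mem hA y hy.1, ?_⟩
      have := L.d_degree _ y hy.2
      rwa [add_sub_cancel_right] at this
    · rw [map_sub, hdz, L.d_d, sub_zero]
    · intro w hw
      rw [Submodule.coe_sub, Pi.sub_apply, hdy w hw, sub_self]
  choose Y hY hYlow hYnext using step
  have hx0 : Q 0 x := ⟨hx, hdx, fun w hw => by
    rw [List.length_eq_zero_iff.1 (Nat.le_zero.1 hw)]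
    exact completedFreeLie_apply_nil x.2⟩
  -- `Z j` is what remains of `x` after `j` corrections. The correction made at stage `j` has no
  -- words shorter than `j`, so the sum of all corrections is finite in each length.
  let Z : ∀ j : ℕ, {z // Q j z} := fun j =>
    Nat.rec ⟨x, hx0⟩ (fun j z => ⟨z.1 - L.d (Y j z), hYnext j z⟩) j
  have hZ : ∀ j, (Z (j + 1)).1 = (Z j).1 - L.d (Y j (Z j)) := fun _ => rfl
  let T : ℕ → CompletedFreeLie deg := fun m => ∑ j ∈ Finset.range m, Y j (Z j)
  have hT : ∀ m, L.d (T m) = x - (Z m).1 := by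
    intro m
    induction m with
    | zero => simp [T, Z]
    | succ m ih =>
      have : T (m + 1) = T m + Y m (Z m) := Finset.sum_range_succ _ _
      rw [this, map_add, ih, hZ]
      abel
  have hTmem : ∀ m, (T m : Series S) ∈ degreePart deg A (k + 1) := by
    intro m
    simp only [T, Submodule.coe_sum]
    exact Submodule.sum_mem _ fun j _ => hY j (Z j)
  have hTstable : ∀ (w : List S) (m : ℕ), w.length < m →
      (T m : Series S) w = (T (w.length + 1) : Series S) w := by
    intro w m hm
    induction m, hm using Nat.le_induction with
    | base => rfl
    | succ m hm ih =>
      have : T (m + 1) = T m + Y m (Z m) := Finset.sum_range_succ _ _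
      rw [this, Submodule.coe_add, Pi.add_apply, hYlow m (Z m) w hm, add_zero, ih]
  let y : Series S := fun w => (T (w.length + 1) : Series S) w
  have hyT : ∀ (m : ℕ) (w : List S), w.length ≤ m → y w = (T (m + 1) : Series S) w :=
    fun m w hw => (hTstable w (m + 1) (by omega)).symm
  have hyc : y ∈ completedFreeLie deg A := by
    intro m
    have : lengthPart m y = lengthPart m (T (m + 1) : Series S) := by
      funext w
      by_cases hw : w.length = m
      · simp only [lengthPart, LinearMap.coe_mk, AddHom.coe_mk, if_pos hw]
        exact hyT m w hw.le
      · simp [lengthPart, hw]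
    rw [this]
    exact (hTmem (m + 1)).1 m
  have hydeg : y ∈ homogeneous deg (k + 1) := fun w hw => (hTmem (w.length + 1)).2 w hw
  refine ⟨⟨y, completedFreeLie_mono (Set.subset_univ A) hyc⟩, ⟨hyc, hydeg⟩, ?_⟩
  apply Subtype.ext
  funext w
  -- Continuity of the differential: the infinite sum and its partial sum agree up to length
  -- `w.length`, hence so do their images; the remainder of `x` vanishes there too.
  have h0 := L.d_filtration w.length
    (⟨y, completedFreeLie_mono (Set.subset_univ A) hyc⟩ - T (w.length + 1)) (by
      intro u hu
      rw [Submodule.coe_sub, Pi.sub_apply]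
      exact sub_eq_zero.2 (hyT _ u hu)) w le_rfl
  rw [map_sub, hT, Submodule.coe_sub, Submodule.coe_sub, Pi.sub_apply, Pi.sub_apply,
    (Z (w.length + 1)).2.2.2 w (by omega), sub_zero, sub_eq_zero] at h0
  exact h0

end Acyclic

/-! ### The contraction of the quadratic part of the differential -/

section Quadratic

variable {S : Type*} {deg : S → ℤ} {ε : S → ℚ}

/-- Each letter is replaced by words of length at least one. -/
theorem superderivation_mem_supported_length {e : ℤ} {g : S → FreeAlgebra ℚ S}
    (hg : ∀ s, g s ∈ supported fun w => w ≠ []) {k : ℕ} {x : FreeAlgebra ℚ S}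
    (hx : x ∈ supported fun w => k ≤ w.length) :
    superderivation deg e g x ∈ supported fun w => k ≤ w.length := by
  suffices h : ∀ w, superderivation deg e g (word w) ∈ supported fun u => w.length ≤ u.length by
    refine supported_le (N := (supported _).comap (superderivation deg e g)) ?_ hx
    intro w hw
    exact supported_mono (fun u hu => hw.trans hu) (h w)
  intro w
  induction w with
  | nil =>
    rw [word_nil, superderivation_one]
    exact zero_mem _
  | cons s w ih =>
    rw [superderivation_word_cons, ← word_singleton]
    refine add_mem (mul_mem_supported ?_ (hg s) (word_mem_supported (p := fun u => u = w) rfl))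
      (Submodule.smul_mem _ _ (mul_mem_supported ?_
        (word_mem_supported (p := fun u => u = [s]) rfl) ih))
    · rintro u v hu rfl
      have := List.length_pos_iff.2 hu
      rw [List.length_append, List.length_cons]
      omega
    · rintro u v rfl hv
      simpa using hv

/-- The contraction of the quadratic part of the differential commutes with the linear part. -/
theorem FreeCDGL.quadratic_contraction_comm [Fintype S] (L : FreeCDGL deg)
    (hε : ∀ s, ε s ≠ 0 → deg s = -1)
    (hlin : ∀ s, ∑ a, ε a * (L.d (ofGen deg s) : Series S) [a] = 0) {c : S → ℚ}
    (hquad : ∀ s t, ∑ a, ε a * (L.d (ofGen deg s) : Series S) [a, t] = c s * gen s [t])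
    (s t : S) (hst : (L.d (ofGen deg s) : Series S) [t] ≠ 0) : c s = c t := by
  classical
  obtain ⟨g, hgL, hgdeg, hgne, hgd⟩ := L.exists_approx_d_gen 2
  let δ := superderivation deg (-1) g
  let h := contraction ε
  have hlow : ∀ {x : FreeAlgebra ℚ S}, x ∈ supported (fun w => 2 ≤ w.length) →
      toSeries S x [t] = 0 := fun hx => mem_supported_iff_toSeries.1 hx [t] (by simp)
  have hgen : ∀ s, h (g s) - c s • FreeAlgebra.ι ℚ s ∈ supported fun w => 2 ≤ w.length := by
    intro s
    refine mem_supported_iff_toSeries.2 fun w hw => ?_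
    rw [map_sub, map_smul, Pi.sub_apply, Pi.smul_apply, toSeries_contraction, toSeries_ι]
    rcases w with _ | ⟨a, _ | ⟨b, w⟩⟩
    · have : ∀ a, toSeries S (g s) [a] = (L.d (ofGen deg s) : Series S) [a] := fun a =>
        (hgd s _ (by simp)).symm
      simp only [this, hlin]
      simp [gen]
    · have : ∀ b, toSeries S (g s) [b, a] = (L.d (ofGen deg s) : Series S) [b, a] := fun a =>
        (hgd s _ (by simp)).symm
      simp only [this, hquad, smul_eq_mul, sub_self]
    · simp at hw
  -- Modulo longer words, `δh + hδ` multiplies a word by the scalar of its first letter; only the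
  -- word `[t]` itself reaches the coefficient at `[t]`.
  have hhom : toSeries S (δ (h (g s)) + h (δ (g s)) - c t • g s) [t] = 0 := by
    have := supported_le (p := fun w => w ≠ [])
      (N := LinearMap.ker (LinearMap.proj [t] ∘ₗ toSeries S ∘ₗ
        (δ ∘ₗ h + h ∘ₗ δ - c t • LinearMap.id))) ?_ (hgne s)
    · exact this
    rintro (_ | ⟨a, w⟩) hw
    · exact absurd rfl hw
    · simp only [LinearMap.mem_ker, LinearMap.comp_apply, LinearMap.sub_apply, LinearMap.add_apply,
        LinearMap.smul_apply, LinearMap.id_apply, LinearMap.proj_apply]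
      rw [contraction_superderivation hε hgne]
      have e : contraction ε (g a) * word w - c t • word (a :: w)
          = (h (g a) - c a • FreeAlgebra.ι ℚ a) * word w + (c a - c t) • word (a :: w) := by
        rw [word_cons, sub_mul, sub_smul, smul_mul_assoc]
        abel
      have h1 : (h (g a) - c a • FreeAlgebra.ι ℚ a) * word w ∈ supported fun w => 2 ≤ w.length :=
        mul_mem_supported (q := fun _ => True) (fun u v hu _ => by
          rw [List.length_append]
          omega) (hgen a) (mem_supported_true _)
      rw [e, map_add, Pi.add_apply, hlow h1, map_smul, Pi.smul_apply, toSeries_word, zero_add]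
      by_cases haw : a :: w = [t]
      · rw [List.cons.injEq] at haw
        rw [haw.1, sub_self, zero_smul]
      · rw [if_neg haw, smul_zero]
  -- This is `d² = 0` on a generator, seen through the truncation at length 2.
  have hδδ : δ (g s) ∈ supported fun w => 3 ≤ w.length := by
    have hgc := toSeries_mem_completedFreeLie (hgL s)
    refine mem_supported_iff_toSeries.2 fun w hw => ?_
    have hw' : w.length ≤ 2 := by omega
    rw [← L.d_eq_superderivation hgdeg hgd (hgL s) hgc hw']
    have h0 := L.d_filtration 2 (L.d (ofGen deg s) - ⟨toSeries S (g s), hgc⟩) (by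
      intro u hu
      rw [Submodule.coe_sub, Pi.sub_apply, sub_eq_zero]
      exact hgd s u hu) w hw'
    rw [map_sub, L.d_d, zero_sub, Submodule.coe_neg, Pi.neg_apply, neg_eq_zero] at h0
    exact h0
  have hhδ : toSeries S (h (δ (g s))) [t] = 0 :=
    hlow (contraction_mem_supported (fun a w _ hw => by simpa using hw) hδδ)
  -- `h (g s)` is `c s • s` plus longer words, and `δ` never shortens words.
  have hδh : toSeries S (δ (h (g s))) [t] = c s * toSeries S (g s) [t] := by
    have h1 := hlow (superderivation_mem_supported_length (deg := deg) (e := -1) hgne (hgen s))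
    rw [map_sub, map_smul, superderivation_ι, map_sub, map_smul, Pi.sub_apply, sub_eq_zero] at h1
    exact h1
  rw [map_sub, map_add, map_smul, Pi.sub_apply, Pi.add_apply, Pi.smul_apply, hhδ, hδh, add_zero,
    smul_eq_mul, ← sub_mul] at hhom
  rw [hgd s [t] (by simp)] at hst
  exact sub_eq_zero.1 ((mul_eq_zero.1 hhom).resolve_right hst)

end Quadratic

/-! ### The models of the simplices -/

/-- The augmentation of the simplicial chains: it is `1` on the vertices. -/
def augmentation (n : ℕ) (σ : Simplex n) : ℚ := if σ.1.card = 1 then 1 else 0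

theorem simplexDeg_of_augmentation_ne_zero {n : ℕ} {σ : Simplex n} (h : augmentation n σ ≠ 0) :
    simplexDeg n σ = -1 := by
  have : σ.1.card = 1 := by
    by_contra h'
    exact h (if_neg h')
  simp [simplexDeg, this]

theorem gen_singleton {S : Type*} [DecidableEq S] (s t : S) :
    gen s [t] = if t = s then (1 : ℚ) else 0 := by
  simp [gen, Pi.single_apply]

/-- Only edges have vertices as facets, and the two endpoints of an edge carry opposite signs. -/
theorem sum_augmentation_boundary (n : ℕ) (σ : Simplex n) :
    ∑ τ, augmentation n τ * boundary n σ [τ] = 0 := by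
  have h1 : ∀ τ, augmentation n τ * boundary n σ [τ] = ∑ v ∈ σ.1,
      if h : (σ.1.erase v).Nonempty then (-1 : ℚ) ^ (σ.1.filter (· < v)).card
        * (augmentation n τ * gen (⟨σ.1.erase v, h⟩ : Simplex n) [τ]) else 0 := by
    intro τ
    rw [boundary, Finset.sum_apply, Finset.mul_sum]
    refine Finset.sum_congr rfl fun v _ => ?_
    split_ifs with h
    · rw [Pi.smul_apply, smul_eq_mul]
      ring
    · simp
  simp only [h1]
  rw [Finset.sum_comm]
  have h2 : ∀ v ∈ σ.1, (∑ τ, if h : (σ.1.erase v).Nonempty then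
      (-1 : ℚ) ^ (σ.1.filter (· < v)).card
        * (augmentation n τ * gen (⟨σ.1.erase v, h⟩ : Simplex n) [τ]) else 0)
      = if σ.1.card = 2 then (-1 : ℚ) ^ (σ.1.filter (· < v)).card else 0 := by
    intro v hv
    have hc := Finset.card_erase_of_mem hv
    split_ifs with h h'
    · rw [← Finset.mul_sum]
      simp [gen_singleton, augmentation, hc, h']
    · rw [← Finset.mul_sum]
      have : σ.1.card - 1 ≠ 1 := by omega
      simp [gen_singleton, augmentation, hc, this]
    · rw [Finset.not_nonempty_iff_eq_empty.1 h] at hc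
      simp at hc
      omega
    · simp
  rw [Finset.sum_congr rfl h2]
  split_ifs with h
  · obtain ⟨a, b, hab, hσ⟩ := Finset.card_eq_two.1 h
    wlog hlt : a < b generalizing a b
    · exact this b a hab.symm (by rw [hσ, Finset.pair_comm])
        (lt_of_le_of_ne (not_lt.1 hlt) hab.symm)
    rw [hσ, Finset.sum_pair hab]
    have e1 : ({a, b} : Finset (Fin (n + 1))).filter (· < a) = ∅ := by
      ext c
      simp only [Finset.mem_filter, Finset.mem_insert, Finset.mem_singleton, Finset.notMem_empty,
        iff_false, not_and]
      rintro (rfl | rfl)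
      exacts [lt_irrefl _, hlt.asymm]
    have e2 : ({a, b} : Finset (Fin (n + 1))).filter (· < b) = {a} := by
      ext c
      simp only [Finset.mem_filter, Finset.mem_insert, Finset.mem_singleton]
      constructor
      · rintro ⟨rfl | rfl, h⟩
        exacts [rfl, absurd h (lt_irrefl _)]
      · rintro rfl
        exact ⟨Or.inl rfl, hlt⟩
    rw [e1, e2]
    simp
  · simp

/-- Erasing distinct vertices gives distinct facets, so no cancellation occurs and the coefficient
is a sign. -/
theorem boundary_apply_erase_ne_zero {n : ℕ} (σ : Simplex n) {v : Fin (n + 1)} (hv : v ∈ σ.1)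
    (h : (σ.1.erase v).Nonempty) : boundary n σ [⟨σ.1.erase v, h⟩] ≠ 0 := by
  rw [boundary, Finset.sum_apply, Finset.sum_eq_single v]
  · rw [dif_pos h, Pi.smul_apply, gen_singleton, if_pos rfl]
    simp
  · intro u hu huv
    split_ifs with h'
    · rw [Pi.smul_apply, gen_singleton, if_neg, smul_zero]
      intro he
      have he' : σ.1.erase v = σ.1.erase u := congrArg Subtype.val he
      have : u ∈ σ.1.erase v := Finset.mem_erase.2 ⟨huv, hu⟩
      rw [he'] at this
      exact absurd rfl (Finset.mem_erase.1 this).1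
    · rfl
  · exact fun h' => absurd hv h'

section Models

variable (M : SimplexModels) {n : ℕ}

theorem SimplexModels.d_gen_apply_singleton (σ τ : Simplex n) :
    ((M.model n).d (ofGen (simplexDeg n) σ) : Series (Simplex n)) [τ] = boundary n σ [τ] := by
  rw [← M.linearPart]
  simp [lengthPart]

/-- The generators attached to the vertices are Maurer-Cartan elements. -/
theorem SimplexModels.d_gen_vertex {σ : Simplex n} (hσ : σ.1.card = 1) :
    ((M.model n).d (ofGen (simplexDeg n) σ) : Series (Simplex n))
      = -(1 / 2 : ℚ) • bracket (simplexDeg n) (gen σ) (gen σ) := by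
  let φ : Fin (0 + 1) ↪o Fin (n + 1) := σ.1.orderEmbOfFin hσ
  let top : Simplex 0 := ⟨Finset.univ, Finset.univ_nonempty⟩
  have htop : simplexMap φ top = σ := by
    apply Subtype.ext
    apply Finset.coe_injective
    simp only [simplexMap, top, φ, Finset.coe_map, Finset.coe_univ, Set.image_univ]
    exact Finset.range_orderEmbOfFin _ _
  have hgen : lieMap (simplexMap φ) (simplexMap_injective φ) (simplexDeg_simplexMap φ)
      (ofGen (simplexDeg 0) top) = ofGen (simplexDeg n) σ := by
    apply Subtype.ext
    simp only [lieMap, ofGen]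
    rw [pushforward_gen (simplexMap_injective φ), htop]
  rw [← hgen, M.natural, M.maurerCartan]
  simp only [lieMap, lie, ofGen, Submodule.coe_smul, map_smul]
  rw [pushforward_bracket (simplexMap_injective φ) (simplexDeg_simplexMap φ),
    pushforward_gen (simplexMap_injective φ), htop]

/-- A vertex generator `a` is odd, so `[a, a] = 2 a·a` and the Maurer-Cartan equation gives `da =
-a·a`. -/
theorem SimplexModels.quadratic_contraction_vertex {σ : Simplex n} (hσ : σ.1.card = 1)
    (τ : Simplex n) : ∑ a, augmentation n a
      * ((M.model n).d (ofGen (simplexDeg n) σ) : Series (Simplex n)) [a, τ] = - gen σ [τ] := by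
  rw [M.d_gen_vertex hσ]
  have h : ∀ a, (-(1 / 2 : ℚ) • bracket (simplexDeg n) (gen σ) (gen σ)) [a, τ]
      = -(gen σ [a] * gen σ [τ]) := by
    intro a
    have h0 : gen σ [] = 0 := by simp [gen]
    simp only [Pi.smul_apply, bracket, List.length_cons, List.length_nil, Finset.sum_range_succ,
      Finset.sum_range_zero, List.take_zero, List.drop_zero, List.take_succ_cons,
      List.drop_succ_cons, h0, List.take_nil, List.drop_nil, smul_eq_mul]
    by_cases ha : a = σ
    · by_cases ht : τ = σ
      · subst ha
        subst ht
        simp [wordDeg, simplexDeg, hσ]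
        ring
      · simp [gen_singleton, ht]
    · simp [gen_singleton, ha]
  simp only [h]
  simp [gen_singleton, augmentation, hσ]

/-- If `a` is a vertex and `a τ` occurs in `dσ`, then `τ` is a face of `σ` by naturality and has the
same degree as `σ`, hence the same number of vertices; this forces `τ = σ`. -/
theorem SimplexModels.quadratic_contraction_offDiagonal {σ τ : Simplex n} (h : τ ≠ σ) :
    ∑ a, augmentation n a
      * ((M.model n).d (ofGen (simplexDeg n) σ) : Series (Simplex n)) [a, τ] = 0 := by
  refine Finset.sum_eq_zero fun a _ => ?_
  by_cases ha : augmentation n a = 0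
  · rw [ha, zero_mul]
  have hadeg := simplexDeg_of_augmentation_ne_zero ha
  by_cases hsub : τ.1 ⊆ σ.1
  · have hs : (ofGen (simplexDeg n) σ : Series (Simplex n))
        ∈ homogeneous (simplexDeg n) (simplexDeg n σ) := by
      have := (IsLieWord.gen (deg := simplexDeg n) σ (Set.mem_univ σ)).mem_supported
      have := mem_supported_iff_toSeries.1 this
      rwa [toSeries_ι] at this
    rw [(M.model n).d_degree _ _ hs, mul_zero]
    intro hdeg
    have hcard : σ.1.card ≤ τ.1.card := by
      simp only [wordDeg, List.map_cons, List.map_nil, List.sum_cons, List.sum_nil, hadeg] at hdeg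
      simp only [simplexDeg] at hdeg
      omega
    exact h (Subtype.ext (Finset.eq_of_subset_of_card_le hsub hcard))
  -- The closed simplex spanned by `σ`: its generators are the only letters that can occur in `dσ`.
  · let X : PreAbstractSimplicialComplex (Fin (n + 1)) :=
      { faces := {s | s.Nonempty ∧ s ⊆ σ.1}
        isRelLowerSet_faces := fun s hs => ⟨hs.1, fun t hts ht => ⟨ht, hts.trans hs.2⟩⟩ }
    have hX := M.d_gen_mem X σ ⟨σ.2, subset_rfl⟩
    rw [completedFreeLie_apply_eq_zero hX (s := τ) (by simp) (fun hτ => hsub hτ.2), mul_zero]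

theorem SimplexModels.quadratic_contraction (σ τ : Simplex n) :
    ∑ a, augmentation n a
      * ((M.model n).d (ofGen (simplexDeg n) σ) : Series (Simplex n)) [a, τ] = - gen σ [τ] := by
  let c : Simplex n → ℚ := fun σ => ∑ a, augmentation n a
    * ((M.model n).d (ofGen (simplexDeg n) σ) : Series (Simplex n)) [a, σ]
  have hc : ∀ σ τ, ∑ a, augmentation n a
      * ((M.model n).d (ofGen (simplexDeg n) σ) : Series (Simplex n)) [a, τ]
      = c σ * gen σ [τ] := by
    intro σ τ
    by_cases h : τ = σ
    · rw [h, gen_singleton, if_pos rfl, mul_one]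
    · rw [M.quadratic_contraction_offDiagonal h, gen_singleton, if_neg h, mul_zero]
  have hcomm := (M.model n).quadratic_contraction_comm
    (fun _ => simplexDeg_of_augmentation_ne_zero)
    (fun σ => by simpa only [M.d_gen_apply_singleton] using sum_augmentation_boundary n σ) hc
  -- Any facet occurs in the linear part with nonzero coefficient, so the scalar of `σ` equals that
  -- of a facet, and finally that of a vertex.
  have hneg : ∀ (m : ℕ) (σ : Simplex n), σ.1.card = m + 1 → c σ = -1 := by
    intro m
    induction m with
    | zero =>
      intro σ hσ
      have := M.quadratic_contraction_vertex hσ σ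
      rwa [gen_singleton, if_pos rfl] at this
    | succ m ih =>
      intro σ hσ
      obtain ⟨v, hv⟩ := σ.2
      have hcard : (σ.1.erase v).card = m + 1 := by rw [Finset.card_erase_of_mem hv]; omega
      have hne : (σ.1.erase v).Nonempty := Finset.card_pos.1 (by omega)
      rw [hcomm σ ⟨_, hne⟩ (by
        rw [M.d_gen_apply_singleton]
        exact boundary_apply_erase_ne_zero σ hv hne)]
      exact ih _ hcard
  have hpos := σ.2.card_pos
  rw [hc, hneg (σ.1.card - 1) σ (by omega), neg_one_mul]

end Models

/-! ### From cycles and boundaries to homology -/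

/-- The model of a simplicial complex is acyclic. -/
theorem SimplexModels.isZero_homology (M : SimplexModels) {n : ℕ}
    (X : PreAbstractSimplicialComplex (Fin (n + 1))) (k : ℤ) :
    Limits.IsZero ((M.complexModel X).homology k) := by
  -- The differentials are indexed as maps from degree `n + 1` to degree `n`, so the outgoing one
  -- needs `k` in successor form.
  obtain ⟨m, rfl⟩ : ∃ m, k = m + 1 := ⟨k - 1, by ring⟩
  rw [← HomologicalComplex.exactAt_iff_isZero_homology,
    HomologicalComplex.exactAt_iff' _ (m + 1 + 1) (m + 1) m (by simp) (by simp),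
    ShortComplex.moduleCat_exact_iff]
  intro (x : degreePart (simplexDeg n) (simplicesOf X) (m + 1)) hx
  let x' := Submodule.inclusion (degreePart_le (simplexDeg n) (simplicesOf X) (m + 1)) x
  have hd : ∀ j : ℤ, (M.complexModel X).d (j + 1) j
      = ModuleCat.ofHom ((M.model n).dPart (simplicesOf X) (M.d_gen_mem X) j) := fun j =>
    ChainComplex.of_d (fun j => ModuleCat.of ℚ (degreePart (simplexDeg n) (simplicesOf X) j))
      (fun j => ModuleCat.ofHom ((M.model n).dPart (simplicesOf X) (M.d_gen_mem X) j)) j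
  have hx0 : (M.model n).d x' = 0 := by
    have h1 : (M.complexModel X).d (m + 1) m x = 0 := hx
    rw [hd] at h1
    have h2 := congrArg Subtype.val h1
    exact Subtype.ext h2
  obtain ⟨y, hy, hdy⟩ := (M.model n).exists_d_eq
    (fun _ => simplexDeg_of_augmentation_ne_zero)
    (fun σ => by simpa only [M.d_gen_apply_singleton] using sum_augmentation_boundary n σ)
    M.quadratic_contraction (M.d_gen_mem X) x' x.2 hx0
  refine ⟨(⟨y, hy⟩ : degreePart (simplexDeg n) (simplicesOf X) (m + 1 + 1)), ?_⟩
  change (M.complexModel X).d (m + 1 + 1) (m + 1) _ = _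
  rw [hd]
  have h2 := congrArg Subtype.val hdy
  exact Subtype.ext h2

end LieModel

theorem mainTheorem5 (M : LieModel.SimplexModels) (n : ℕ)
    (X : PreAbstractSimplicialComplex (Fin (n + 1))) (hX : LieModel.IsConnected X) :
    ∀ k : ℤ, CategoryTheory.Limits.IsZero ((M.complexModel X).homology k) := by
  exact fun k => M.isZero_homology X k

end
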